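/- Setting. Let $m_1,m_2,n\ge 1$, $m=\min(m_1,m_2)$, $d=m_1+m_2$. Let $\Pi=(\pi_{kl})$ be a probability distribution on $[m_1]\times[m_2]$ and let $T_1,\dots,T_n$ be i.i.d. random matrices with $\mathbb P(T_i=e_ke_l^\top)=\pi_{kl}$. One observes $(T_i,Y_i)$, $Y_i=\langle T_i,A_0\rangle+\sigma\xi_i$, where $A_0\in\mathbb R^{m_1\times m_2}$, $\sigma>0$, and the $\xi_i$ are independent real random variables, independent of the $T_i$, with $\mathbb E\xi_i=0$, $\mathbb E\xi_i^2=1$. For $a>0$ let $\mathrm{TL1}_a(A)=\sum_{j=1}^{m}\frac{(a+1)\sigma_j(A)}{a+\sigma_j(A)}$, where $\sigma_j(A)$ are the singular values of $A$, and let $\|A\|_\infty=\max_{k,l}|A(k,l)|$. For $\lambda>0$ and a constant $\zeta$, let $\hat A$ be any minimizer of $\frac1n\sum_{i=1}^n(Y_i-\langle T_i,A\rangle)^2+\lambda\,\mathrm{TL1}_a(A)$ over $\{A:\|A\|_\infty\le\zeta\}$. Put $$\Lambda=\frac{\zeta\vee\sigma}{\sqrt{m_1m_2}}\cdot\frac{a+\zeta\sqrt{m_1m_2}}{1+a}\sqrt{\frac{Ld\log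 d}{n}}.$$ Assumptions. (1) $\sum_l\pi_{kl}\le L/m$ for all $k$ and $\sum_k\pi_{kl}\le L/m$ for all $l$, with $L\ge1$. (2) $\frac1{\nu m_1m_2}\le\pi_{kl}\le\frac{\nu}{m_1m_2}$ for all $k,l$, with $\nu\ge1$. (3) $\max_i\mathbb E\exp(|\xi_i|/c_0)\le e$, with $c_0>0$. Theorem. There is a function $\kappa=\kappa(L)$ of $L$ only such that the following holds. For all $c_0,c_n>0$ there is $\underline c>0$ (depending only on $c_0,c_n$) such that for all $\overline c\ge\underline c$ and $K>0$ there are constants $C_3,C_4>0$, depending only on $c_0$ and on the implied constants $c_n,\overline c,K$, with this property: whenever (1)–(3) hold, $\mathrm{rank}(A_0)\le\tau$ for an integer $\tau$, $\|A_0\|_\infty\le\zeta$, $\underline c\,\Lambda\le\lambda\le\overline c\,\Lambda$ (i.e. $\lambda\asymp\Lambda$ with a large enough lower constant), $n\ge c_n\,d\log d$, and $\zeta\sqrt{m_1m_2}\le K a$ (i.e. $a^{-1}=\mathcal O((\zeta\sqrt{m_1m_2})^{-1})$), then with probability at least $1-\frac{\kappa+1}{d}$, $$\frac{\|\hat A-A_0\|_F^2}{m_1m_2}\le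 C_3\,\nu^2(\zeta^2\vee\sigma^2)\,\mathrm{rank}(A_0)\,\frac{Ld\log d}{n}+C_4\,\nu\,\zeta^2\sqrt{\frac{L\log d}{n}}.$$ -/

import Mathlib

open MeasureTheory ProbabilityTheory

noncomputable section

namespace TLone

/-- Real matrices carry the product (Borel) σ-algebra of their entries. -/
instance matrixMeasurableSpace (m₁ m₂ : ℕ) :
    MeasurableSpace (Matrix (Fin m₁) (Fin m₂) ℝ) :=
  inferInstanceAs (MeasurableSpace (Fin m₁ → Fin m₂ → ℝ))

/-- The trace inner product `⟨B, A⟩ = tr(Bᵀ A)`. -/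
def traceInner {m₁ m₂ : ℕ} (B A : Matrix (Fin m₁) (Fin m₂) ℝ) : ℝ :=
  (B.transpose * A).trace

/-- The Frobenius norm. -/
def frobNorm {m₁ m₂ : ℕ} (A : Matrix (Fin m₁) (Fin m₂) ℝ) : ℝ :=
  √(∑ k, ∑ l, A k l ^ 2)

/-- The entrywise bound `‖A‖_∞ = max_{k,l} |A(k,l)| ≤ ζ`. -/
def MaxNormLE {m₁ m₂ : ℕ} (A : Matrix (Fin m₁) (Fin m₂) ℝ) (ζ : ℝ) : Prop :=
  ∀ k l, |A k l| ≤ ζ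

/-- The singular values of a matrix, in decreasing order and starting at index `0`; they vanish
from index `min m₁ m₂` on. -/
def sv {m₁ m₂ : ℕ} (A : Matrix (Fin m₁) (Fin m₂) ℝ) (j : ℕ) : ℝ :=
  (Matrix.toEuclideanLin A).singularValues j

/-- The transformed `ℓ¹` penalty of the singular values, with parameter `a > 0`. -/
def TL1 {m₁ m₂ : ℕ} (a : ℝ) (A : Matrix (Fin m₁) (Fin m₂) ℝ) : ℝ :=
  ∑ j ∈ Finset.range (min m₁ m₂), (a + 1) * sv A j / (a + sv A j)

/-- `Π = (π_kl)` is a probability distribution on the positions `(k, l)`. -/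
structure IsDistribution {m₁ m₂ : ℕ} (π : Matrix (Fin m₁) (Fin m₂) ℝ) : Prop where
  nonneg : ∀ k l, 0 ≤ π k l
  sum_eq_one : ∑ k, ∑ l, π k l = 1

/-- The law of a random indicator matrix `e_k e_lᵀ` whose position `(k, l)` has law `Π`. -/
def indicatorLaw {m₁ m₂ : ℕ} (π : Matrix (Fin m₁) (Fin m₂) ℝ) :
    Measure (Matrix (Fin m₁) (Fin m₂) ℝ) :=
  ∑ k, ∑ l, ENNReal.ofReal (π k l) • Measure.dirac (Matrix.single k l (1 : ℝ))

/-- The row probabilities `R_k` and the column probabilities `C_l` are at most `L / min m₁ m₂`. -/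
def MarginalsLE {m₁ m₂ : ℕ} (π : Matrix (Fin m₁) (Fin m₂) ℝ) (L : ℝ) : Prop :=
  (∀ k, ∑ l, π k l ≤ L / (min m₁ m₂ : ℕ)) ∧ (∀ l, ∑ k, π k l ≤ L / (min m₁ m₂ : ℕ))

/-- Every entry of `Π` is within a factor `ν` of the uniform weight `1 / (m₁ m₂)`. -/
def EntriesComparable {m₁ m₂ : ℕ} (π : Matrix (Fin m₁) (Fin m₂) ℝ) (ν : ℝ) : Prop :=
  ∀ k l, 1 / (ν * (m₁ * m₂ : ℝ)) ≤ π k l ∧ π k l ≤ ν / (m₁ * m₂ : ℝ)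

/-- The trace regression model: the observations are `(T i, Y i)`, `Y i = ⟨T i, A₀⟩ + σ ξ i`, where
the `T i` are i.i.d. random indicator matrices with distribution `Π`, the noise variables `ξ i` are
independent, centered and of unit variance, and the noise is independent of the `T i`. -/
structure TraceRegression {Ω : Type*} [MeasurableSpace Ω] (μ : Measure Ω) {m₁ m₂ n : ℕ}
    (π A₀ : Matrix (Fin m₁) (Fin m₂) ℝ) (σ : ℝ)
    (T : Fin n → Ω → Matrix (Fin m₁) (Fin m₂) ℝ) (ξ Y : Fin n → Ω → ℝ) : Prop where
  measurable_T : ∀ i, Measurable (T i)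
  measurable_noise : ∀ i, Measurable (ξ i)
  law_T : ∀ i, μ.map (T i) = indicatorLaw π
  indep_pairs : iIndepFun (fun i ω => (T i ω, ξ i ω)) μ
  indep_noise : ∀ i, IndepFun (T i) (ξ i) μ
  noise_integrable : ∀ i, Integrable (ξ i) μ
  noise_mean : ∀ i, ∫ ω, ξ i ω ∂μ = 0
  noise_sq_integrable : ∀ i, Integrable (fun ω => ξ i ω ^ 2) μ
  noise_variance : ∀ i, ∫ ω, ξ i ω ^ 2 ∂μ = 1
  obs : ∀ i ω, Y i ω = traceInner (T i ω) A₀ + σ * ξ i ω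

/-- The uniform sub-exponential bound `max_i E exp(|ξ_i| / c₀) ≤ e`. -/
def SubExponential {Ω : Type*} [MeasurableSpace Ω] (μ : Measure Ω) {n : ℕ}
    (ξ : Fin n → Ω → ℝ) (c₀ : ℝ) : Prop :=
  ∀ i, Integrable (fun ω => Real.exp (|ξ i ω| / c₀)) μ ∧
    ∫ ω, Real.exp (|ξ i ω| / c₀) ∂μ ≤ Real.exp 1

/-- The penalized least-squares objective for observed data `(t i, y i)`. -/
def objective {m₁ m₂ n : ℕ} (t : Fin n → Matrix (Fin m₁) (Fin m₂) ℝ) (y : Fin n → ℝ)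
    (lam a : ℝ) (A : Matrix (Fin m₁) (Fin m₂) ℝ) : ℝ :=
  (1 / (n : ℝ)) * ∑ i, (y i - traceInner (t i) A) ^ 2 + lam * TL1 a A

/-- `A` is a global minimizer of the objective over the matrices with entries at most `ζ` in
absolute value. -/
def IsEstimator {m₁ m₂ n : ℕ} (t : Fin n → Matrix (Fin m₁) (Fin m₂) ℝ) (y : Fin n → ℝ)
    (lam a ζ : ℝ) (A : Matrix (Fin m₁) (Fin m₂) ℝ) : Prop :=
  MaxNormLE A ζ ∧
    ∀ B : Matrix (Fin m₁) (Fin m₂) ℝ, MaxNormLE B ζ →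
      objective t y lam a A ≤ objective t y lam a B

/-- The order of the regularization parameter, with `d = m₁ + m₂`:
`(ζ ∨ σ)/√(m₁m₂) · (a + ζ√(m₁m₂))/(1 + a) · √(L d log d / n)`. -/
def lamRate (m₁ m₂ n : ℕ) (ζ σ a L : ℝ) : ℝ :=
  max ζ σ / √(m₁ * m₂ : ℝ) * ((a + ζ * √(m₁ * m₂ : ℝ)) / (1 + a)) *
    √(L * (m₁ + m₂ : ℝ) * Real.log (m₁ + m₂ : ℝ) / n)

end TLone

end

/-! Write Δ for the estimation error, r for the rank of `A₀` and s = ζ√(m₁m₂). Comparing the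
objective at the estimator and at the feasible point `A₀` bounds the empirical squared norm of Δ by
a noise term (2σ/n)⟨Σ ξᵢTᵢ, Δ⟩ plus λ times a difference of penalties. The scalar penalty is
(1+a)/a-Lipschitz and lies above the line of slope (1+a)/(a+s) on [0, s]. So the penalty difference
is at most (1+a)/a · √r‖Δ‖_F minus (1+a)/(a+s) times the sum of the singular values of the estimator
beyond the r-th (`TL1_sub_le`). The noise pairing is at most an operator norm times that same tail
plus 3√r‖Δ‖_F (`hs_sub_le`). When λ has a large enough constant, the penalty tail beats the noise
tail. Hence the tail is O(√r‖Δ‖_F), and Δ has the nuclear norm of a matrix of rank of order r. The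
condition s ≤ Ka keeps the two slopes comparable.

Two random quantities remain. The operator norm of Σ ξᵢTᵢ is handled by a matrix Laplace transform.
The dilation D of an indicator matrix satisfies D³ = D, so exp(sD) is explicit. Golden–Thompson and
the marginal bounds then show that each independent summand multiplies the expected trace
exponential by at most a scalar (`lintegral_trace_exp_add_le`).

The other quantity is the deviation of the empirical squared norm below the L²(Π) one, uniformly
over matrices with bounded entries and bounded nuclear norm. Symmetrization and contraction reduce
its exponential moment to a linear Rademacher process. Duality of nuclear and operator norms bounds
that process by the same trace exponential (`pi_posLaw_deviation_le`). Since the class is stable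
under shrinking, one radius suffices and no peeling over scales is needed (`sqNorm_le_or_lt`).

On the good event either the L²(Π) norm of Δ is already of the target order, or its square is at
most a constant times itself times the rate, which can be solved. Both cases give the first term of
the bound alone. The two bad events have probability at most 1/d each, so κ = 1 works. -/

noncomputable section

namespace TLone

/-! ### Trace and perturbation inequalities for singular values. -/

section SingularValues

variable {E F : Type*} [NormedAddCommGroup E] [InnerProductSpace ℝ E] [FiniteDimensional ℝ E]
  [NormedAddCommGroup F] [InnerProductSpace ℝ F] [FiniteDimensional ℝ F]

/-- Abel summation. The induction carries the stronger claim that the weighted sum is at least the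
current weight times the unweighted partial sum. -/
theorem sum_mul_nonneg_of_antitone {x c : ℕ → ℝ} (hx : Antitone x) (hx0 : ∀ i, 0 ≤ x i)
    (hc : ∀ k, 0 ≤ ∑ i ∈ Finset.range k, c i) (n : ℕ) :
    0 ≤ ∑ i ∈ Finset.range n, x i * c i := by
  have key : ∀ k, x k * ∑ i ∈ Finset.range k, c i ≤ ∑ i ∈ Finset.range k, x i * c i := by
    intro k
    induction k with
    | zero => simp
    | succ k ih =>
      have h1 := mul_le_mul_of_nonneg_right (hx (Nat.le_succ k)) (hc (k + 1))
      rw [Finset.sum_range_succ] at h1 ⊢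
      rw [Finset.sum_range_succ (fun i => x i * c i)]
      simp only [Nat.succ_eq_add_one] at h1
      linarith [mul_add (x k) (∑ i ∈ Finset.range k, c i) (c k)]
  exact (mul_nonneg (hx0 n) (hc n)).trans (key n)

/-- A bilinear form with doubly substochastic coefficients is at most the diagonal pairing on
nonnegative decreasing sequences. -/
theorem sum_substochastic_le {n : ℕ} {x y : ℕ → ℝ} (hx : Antitone x) (hx0 : ∀ i, 0 ≤ x i)
    (hy : Antitone y) (hy0 : ∀ i, 0 ≤ y i) {M : Fin n → Fin n → ℝ} (hM : ∀ i j, 0 ≤ M i j)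
    (hrow : ∀ i, ∑ j, M i j ≤ 1) (hcol : ∀ j, ∑ i, M i j ≤ 1) :
    ∑ i, ∑ j, M i j * (x i * y j) ≤ ∑ i : Fin n, x i * y i := by
  classical
  -- Extending `M` by zero makes sums over arbitrary initial segments available, as Abel summation
  -- requires.
  set N : ℕ → ℕ → ℝ := fun i j => if h : i < n ∧ j < n then M ⟨i, h.1⟩ ⟨j, h.2⟩ else 0 with hN
  have N0 : ∀ i j, 0 ≤ N i j := by
    intro i j; simp only [hN]; split_ifs <;> simp [hM]
  have Nrow' : ∀ i, ∑ j ∈ Finset.range n, N i j ≤ 1 := by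
    intro i
    rw [Finset.sum_range]
    by_cases h : i < n
    · simpa [hN, h] using hrow ⟨i, h⟩
    · simp [hN, h]
  have Ncol' : ∀ j, ∑ i ∈ Finset.range n, N i j ≤ 1 := by
    intro j
    rw [Finset.sum_range]
    by_cases h : j < n
    · simpa [hN, h] using hcol ⟨j, h⟩
    · simp [hN, h]
  have ext_le : ∀ (f : ℕ → ℝ), (∀ i, 0 ≤ f i) → (∀ i, n ≤ i → f i = 0) → ∀ k,
      ∑ i ∈ Finset.range k, f i ≤ ∑ i ∈ Finset.range n, f i := by
    intro f hf hf' k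
    rcases le_total k n with h | h
    · exact Finset.sum_le_sum_of_subset_of_nonneg (Finset.range_mono h) (fun i _ _ => hf i)
    · rw [← Finset.sum_subset (Finset.range_mono h)]
      intro i _ hi; exact hf' i (by simpa using hi)
  have Nrow : ∀ i k, ∑ j ∈ Finset.range k, N i j ≤ 1 := fun i k =>
    (ext_le _ (N0 i) (fun j hj => by simp [hN, hj.not_gt]) k).trans (Nrow' i)
  have Ncol : ∀ j k, ∑ i ∈ Finset.range k, N i j ≤ 1 := fun j k =>
    (ext_le _ (fun i => N0 i j) (fun i hi => by simp [hN, hi.not_gt]) k).trans (Ncol' j)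
  -- Abel summation is used twice: here in `y` for a fixed initial segment of rows, and then in `x`
  -- over the rows.
  have inner : ∀ k, 0 ≤ ∑ i ∈ Finset.range k, (if i < n then y i else 0) -
      ∑ i ∈ Finset.range k, ∑ j ∈ Finset.range n, N i j * y j := by
    intro k
    have h1 : ∑ i ∈ Finset.range k, (if i < n then y i else 0)
        = ∑ j ∈ Finset.range n, y j * (if j < k then 1 else 0) := by
      rw [← Finset.sum_filter]
      simp only [mul_ite, mul_one, mul_zero]
      rw [← Finset.sum_filter]
      congr 1
      ext i; simp [and_comm]
    have h2 : ∑ i ∈ Finset.range k, ∑ j ∈ Finset.range n, N i j * y j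
        = ∑ j ∈ Finset.range n, y j * ∑ i ∈ Finset.range k, N i j := by
      rw [Finset.sum_comm]
      refine Finset.sum_congr rfl fun j _ => ?_
      rw [Finset.mul_sum]
      exact Finset.sum_congr rfl fun i _ => mul_comm _ _
    rw [h1, h2, ← Finset.sum_sub_distrib]
    simp_rw [← mul_sub]
    refine sum_mul_nonneg_of_antitone hy hy0 (fun l => ?_) n
    rw [Finset.sum_sub_distrib, sub_nonneg]
    -- The remaining inequality says that the entries in an l × k corner sum to at most min(l, k).
    -- It follows from the column sums if l ≤ k and from the row sums otherwise.
    have hcard : ∑ j ∈ Finset.range l, (if j < k then (1 : ℝ) else 0) = (min l k : ℕ) := by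
      rw [← Finset.sum_filter, Finset.sum_const, nsmul_eq_mul, mul_one]
      congr 1
      rw [show (Finset.range l).filter (fun j => j < k) = Finset.range (min l k) by
        ext j; simp]
      simp
    rw [hcard]
    rcases le_total l k with h | h
    · rw [min_eq_left h]
      calc _ ≤ ∑ j ∈ Finset.range l, (1 : ℝ) := Finset.sum_le_sum fun j _ => Ncol j k
        _ = l := by simp
    · rw [min_eq_right h, Finset.sum_comm]
      calc _ ≤ ∑ j ∈ Finset.range k, (1 : ℝ) := Finset.sum_le_sum fun j _ => Nrow j l
        _ = k := by simp
  have main := sum_mul_nonneg_of_antitone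
    (c := fun i => (if i < n then y i else 0) - ∑ j ∈ Finset.range n, N i j * y j) hx hx0
    (fun k => by rw [Finset.sum_sub_distrib]; exact inner k) n
  rw [Finset.sum_range] at main
  simp only [Fin.is_lt, if_true, mul_sub, Finset.sum_sub_distrib, sub_nonneg] at main
  refine le_trans (le_of_eq ?_) main
  refine Finset.sum_congr rfl fun i _ => ?_
  rw [Finset.sum_range, Finset.mul_sum]
  refine Finset.sum_congr rfl fun j _ => ?_
  simp only [hN, Fin.is_lt, and_self, dif_pos, Fin.eta]
  ring

/-- The Hilbert–Schmidt inner product of linear maps. -/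
def hs (A B : E →ₗ[ℝ] F) : ℝ := LinearMap.trace ℝ E (A.adjoint ∘ₗ B)

theorem hs_eq_sum {ι : Type*} [Fintype ι] (b : OrthonormalBasis ι ℝ E) (A B : E →ₗ[ℝ] F) :
    hs A B = ∑ i, inner ℝ (A (b i)) (B (b i)) := by
  rw [hs, LinearMap.trace_eq_sum_inner _ b]
  simp [LinearMap.adjoint_inner_right]

theorem hs_self_eq_sum {ι : Type*} [Fintype ι] (b : OrthonormalBasis ι ℝ E) (A : E →ₗ[ℝ] F) :
    hs A A = ∑ i, ‖A (b i)‖ ^ 2 := by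
  rw [hs_eq_sum b]; simp

/-- An orthonormal basis of right singular vectors. -/
def rightBasis (A : E →ₗ[ℝ] F) {n : ℕ} (hn : Module.finrank ℝ E = n) :
    OrthonormalBasis (Fin n) ℝ E :=
  A.isSymmetric_adjoint_comp_self.eigenvectorBasis hn

theorem inner_apply_rightBasis (A : E →ₗ[ℝ] F) {n : ℕ} (hn : Module.finrank ℝ E = n)
    (i j : Fin n) : inner ℝ (A (rightBasis A hn i)) (A (rightBasis A hn j))
      = if i = j then A.singularValues j ^ 2 else 0 := by
  have h := A.isSymmetric_adjoint_comp_self.apply_eigenvectorBasis hn j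
  rw [← LinearMap.adjoint_inner_right]
  change inner ℝ _ ((A.adjoint ∘ₗ A) _) = _
  rw [rightBasis, h, inner_smul_right, A.sq_singularValues_fin hn]
  have := orthonormal_iff_ite.mp (A.isSymmetric_adjoint_comp_self.eigenvectorBasis hn).orthonormal
    i j
  rw [this]
  split_ifs <;> simp

theorem norm_apply_rightBasis (A : E →ₗ[ℝ] F) {n : ℕ} (hn : Module.finrank ℝ E = n) (j : Fin n) :
    ‖A (rightBasis A hn j)‖ = A.singularValues j := by
  have h := inner_apply_rightBasis A hn j j
  rw [real_inner_self_eq_norm_sq, if_pos rfl] at h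
  exact (sq_eq_sq₀ (norm_nonneg _) (A.singularValues_nonneg _)).mp h

theorem hs_self_eq_sum_singularValues (A : E →ₗ[ℝ] F) {n : ℕ} (hn : Module.finrank ℝ E = n) :
    hs A A = ∑ j : Fin n, A.singularValues j ^ 2 := by
  rw [hs_self_eq_sum (rightBasis A hn)]
  simp [norm_apply_rightBasis]

-- Bessel's inequality by expanding ‖y − Σ⟨uᵢ,y⟩uᵢ‖² ≥ 0. Norms at most one, rather than equal to
-- one, leave room for zero left singular vectors.
omit [FiniteDimensional ℝ F] in
theorem sum_inner_sq_le {ι : Type*} [Fintype ι] {u : ι → F}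
    (h0 : ∀ i j, i ≠ j → inner ℝ (u i) (u j) = 0) (h1 : ∀ i, ‖u i‖ ≤ 1) (y : F) :
    ∑ i, inner ℝ (u i) y ^ 2 ≤ ‖y‖ ^ 2 := by
  classical
  have h := sq_nonneg ‖y - ∑ i, inner ℝ (u i) y • u i‖
  rw [norm_sub_sq_real] at h
  have h2 : inner ℝ y (∑ i, inner ℝ (u i) y • u i) = ∑ i, inner ℝ (u i) y ^ 2 := by
    rw [inner_sum]
    refine Finset.sum_congr rfl fun i _ => ?_
    rw [inner_smul_right, real_inner_comm, sq]
  have h3 : ‖∑ i, inner ℝ (u i) y • u i‖ ^ 2 ≤ ∑ i, inner ℝ (u i) y ^ 2 := by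
    rw [← real_inner_self_eq_norm_sq, sum_inner]
    refine Finset.sum_le_sum fun i _ => ?_
    rw [inner_sum, Finset.sum_eq_single i]
    · rw [inner_smul_left, inner_smul_right, real_inner_self_eq_norm_sq]
      have : ‖u i‖ ^ 2 ≤ 1 := pow_le_one₀ (norm_nonneg _) (h1 i)
      simp only [conj_trivial]
      nlinarith [sq_nonneg (inner ℝ (u i) y)]
    · intro j _ hj
      simp [inner_smul_left, inner_smul_right, h0 i j hj.symm]
    · simp
  linarith

/-- The vectors are σⱼ⁻¹ A vⱼ. Since 0⁻¹ = 0 they vanish where σⱼ = 0, so no completion to an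
orthonormal system is needed. -/
theorem exists_leftVectors (A : E →ₗ[ℝ] F) {n : ℕ} (hn : Module.finrank ℝ E = n) :
    ∃ u : Fin n → F, (∀ j, A (rightBasis A hn j) = A.singularValues j • u j) ∧
      (∀ i j, i ≠ j → inner ℝ (u i) (u j) = 0) ∧ ∀ i, ‖u i‖ ≤ 1 := by
  refine ⟨fun j => (A.singularValues j)⁻¹ • A (rightBasis A hn j), fun j => ?_, fun i j hij => ?_,
    fun i => ?_⟩
  · by_cases h : A.singularValues j = 0
    · have := norm_apply_rightBasis A hn j
      rw [h, norm_eq_zero] at this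
      simp [h, this]
    · rw [smul_smul, mul_inv_cancel₀ h, one_smul]
  · simp [inner_smul_left, inner_smul_right, inner_apply_rightBasis, hij]
  · rw [norm_smul, norm_apply_rightBasis, norm_inv, Real.norm_of_nonneg (A.singularValues_nonneg _)]
    exact inv_mul_le_one

/-- **Von Neumann's trace inequality.** -/
theorem hs_le_sum_singularValues_mul (A B : E →ₗ[ℝ] F) {n : ℕ} (hn : Module.finrank ℝ E = n) :
    hs A B ≤ ∑ j : Fin n, A.singularValues j * B.singularValues j := by
  obtain ⟨u, hu, hu0, hu1⟩ := exists_leftVectors A hn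
  obtain ⟨w, hw, hw0, hw1⟩ := exists_leftVectors B hn
  set a := rightBasis A hn
  set b := rightBasis B hn
  have hexp : hs A B = ∑ i, ∑ j, (inner ℝ (u i) (w j) * inner ℝ (b j) (a i)) *
      (A.singularValues i * B.singularValues j) := by
    rw [hs_eq_sum a]
    refine Finset.sum_congr rfl fun i _ => ?_
    have h1 : B (a i) = ∑ j, inner ℝ (b j) (a i) • B (b j) := by
      conv_lhs => rw [← b.sum_repr' (a i)]
      simp
    rw [h1, inner_sum]
    refine Finset.sum_congr rfl fun j _ => ?_
    rw [hu, hw, inner_smul_right, inner_smul_left, inner_smul_right]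
    simp only [conj_trivial]
    ring
  -- The product of the two cosines is at most the mean of their squares. Bessel bounds each family
  -- of squares, so this matrix is doubly substochastic.
  set M : Fin n → Fin n → ℝ := fun i j =>
    (inner ℝ (u i) (w j) ^ 2 + inner ℝ (b j) (a i) ^ 2) / 2
  have h1 : hs A B ≤ ∑ i, ∑ j, M i j * (A.singularValues i * B.singularValues j) := by
    rw [hexp]
    refine Finset.sum_le_sum fun i _ => Finset.sum_le_sum fun j _ => ?_
    refine mul_le_mul_of_nonneg_right ?_
      (mul_nonneg (A.singularValues_nonneg _) (B.singularValues_nonneg _))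
    simp only [M]
    nlinarith [sq_nonneg (inner ℝ (u i) (w j) - inner ℝ (b j) (a i))]
  refine h1.trans (sum_substochastic_le A.singularValues_antitone A.singularValues_nonneg
    B.singularValues_antitone B.singularValues_nonneg (fun i j => by positivity) ?_ ?_)
  · intro i
    simp only [M]
    rw [← Finset.sum_div, Finset.sum_add_distrib]
    have e1 := sum_inner_sq_le hw0 hw1 (u i)
    have e2 := sum_inner_sq_le (u := b) (fun i j hij => b.orthonormal.2 hij)
      (fun i => (b.orthonormal.1 i).le) (a i)
    rw [a.orthonormal.1 i] at e2
    have e3 : ‖u i‖ ^ 2 ≤ 1 := pow_le_one₀ (norm_nonneg _) (hu1 i)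
    simp_rw [real_inner_comm (u i)]  at e1
    linarith
  · intro j
    simp only [M]
    rw [← Finset.sum_div, Finset.sum_add_distrib]
    have e1 := sum_inner_sq_le hu0 hu1 (w j)
    have e2 := sum_inner_sq_le (u := a) (fun i j hij => a.orthonormal.2 hij)
      (fun i => (a.orthonormal.1 i).le) (b j)
    rw [b.orthonormal.1 j] at e2
    have e3 : ‖w j‖ ^ 2 ≤ 1 := pow_le_one₀ (norm_nonneg _) (hw1 j)
    simp_rw [real_inner_comm (b j)] at e2
    linarith

/-- **Mirsky's inequality** for the Hilbert–Schmidt norm. -/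
theorem sum_sq_singularValues_sub_le (A B : E →ₗ[ℝ] F) {n : ℕ} (hn : Module.finrank ℝ E = n) :
    ∑ j : Fin n, (A.singularValues j - B.singularValues j) ^ 2 ≤ hs (A - B) (A - B) := by
  have h1 : hs (A - B) (A - B) = hs A A - 2 * hs A B + hs B B := by
    set b := stdOrthonormalBasis ℝ E
    rw [hs_eq_sum b, hs_eq_sum b A A, hs_eq_sum b A B, hs_eq_sum b B B, Finset.mul_sum,
      ← Finset.sum_sub_distrib, ← Finset.sum_add_distrib]
    refine Finset.sum_congr rfl fun i _ => ?_
    simp only [LinearMap.sub_apply, inner_sub_left, inner_sub_right]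
    rw [real_inner_comm (A (b i)) (B (b i))]
    ring
  have h2 := hs_le_sum_singularValues_mul A B hn
  rw [h1, hs_self_eq_sum_singularValues A hn, hs_self_eq_sum_singularValues B hn]
  simp_rw [sub_sq]
  rw [Finset.sum_add_distrib, Finset.sum_sub_distrib]
  simp_rw [mul_assoc]
  rw [← Finset.mul_sum]
  linarith

theorem sum_filter_lt_le {n : ℕ} (r : ℕ) (f : Fin n → ℝ) :
    ∑ j with j.val < r, f j ≤ √r * √(∑ j, f j ^ 2) := by
  have hcard : ((Finset.univ.filter (fun j : Fin n => j.val < r)).card : ℝ) ≤ r := by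
    have := Finset.card_le_card_of_injOn (s := Finset.univ.filter (fun j : Fin n => j.val < r))
      (t := Finset.range r) Fin.val (fun j hj => by simpa using hj) (Fin.val_injective.injOn)
    simp only [Finset.card_range] at this
    exact_mod_cast this
  rw [← Real.sqrt_mul (Nat.cast_nonneg r)]
  refine Real.le_sqrt_of_sq_le ?_
  refine (sq_sum_le_card_mul_sum_sq).trans ?_
  refine mul_le_mul hcard ?_ (Finset.sum_nonneg fun _ _ => sq_nonneg _) (Nat.cast_nonneg r)
  exact Finset.sum_le_univ_sum_of_nonneg fun _ => sq_nonneg _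

/-- In a right singular basis of `B` the pairing is at most `z` times the sum of the singular
values, of which at most `r` are nonzero; Cauchy–Schwarz then gives √r. -/
theorem hs_le_of_finrank_range_le {Z B : E →ₗ[ℝ] F} {z : ℝ} (hz : 0 ≤ z)
    (hZ : ∀ x, ‖Z x‖ ≤ z * ‖x‖) {r : ℕ} (hr : Module.finrank ℝ (LinearMap.range B) ≤ r) :
    hs Z B ≤ z * (√r * √(hs B B)) := by
  have hn : Module.finrank ℝ E = Module.finrank ℝ E := rfl
  rw [hs_eq_sum (rightBasis B hn), hs_self_eq_sum_singularValues B hn]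
  have h1 : ∀ j, inner ℝ (Z (rightBasis B hn j)) (B (rightBasis B hn j))
      ≤ z * B.singularValues j := by
    intro j
    refine (real_inner_le_norm _ _).trans ?_
    rw [norm_apply_rightBasis]
    refine mul_le_mul_of_nonneg_right ?_ (B.singularValues_nonneg _)
    simpa using hZ (rightBasis B hn j)
  refine (Finset.sum_le_sum fun j _ => h1 j).trans ?_
  rw [← Finset.mul_sum]
  refine mul_le_mul_of_nonneg_left (le_trans (le_of_eq ?_) (sum_filter_lt_le r _)) hz
  rw [Finset.sum_filter]
  refine Finset.sum_congr rfl fun j _ => ?_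
  split_ifs with h
  · rfl
  · exact B.singularValues_eq_zero_iff_le_finrank_range.mpr (hr.trans (not_lt.mp h))

/-- Pairing of an operator of norm at most `z` with a perturbation of an operator of rank `r`. -/
theorem hs_sub_le {Z X A : E →ₗ[ℝ] F} {z : ℝ} (hz : 0 ≤ z) (hZ : ∀ x, ‖Z x‖ ≤ z * ‖x‖)
    {n : ℕ} (hn : Module.finrank ℝ E = n) {r : ℕ}
    (hr : Module.finrank ℝ (LinearMap.range A) ≤ r) :
    hs Z (X - A) ≤ z * ((∑ j : Fin n with ¬ j.val < r, X.singularValues j)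
      + 3 * (√r * √(hs (X - A) (X - A)))) := by
  set v := rightBasis X hn with hv
  set Δ := X - A with hΔ
  -- `Q` projects onto the right singular vectors of `X` beyond the first `r`. On its range Δ = X −
  -- A splits into the tail of `X` and the operator −AQ of rank at most `r`; on the complement Δ is
  -- kept.
  set Q : E →ₗ[ℝ] E := v.toBasis.constr ℝ (fun j => if j.val < r then 0 else v j) with hQ
  have Qv : ∀ j, Q (v j) = if j.val < r then 0 else v j := by
    intro j
    have := v.toBasis.constr_basis ℝ (fun j => if j.val < r then 0 else v j) j
    rwa [v.coe_toBasis] at this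
  have hAQ : Module.finrank ℝ (LinearMap.range (A ∘ₗ Q)) ≤ r :=
    (Submodule.finrank_mono (LinearMap.range_comp_le_range Q A)).trans hr
  have hZv : ∀ j, ‖Z (v j)‖ ≤ z := fun j => by simpa using hZ (v j)
  have e1 : hs Z Δ = (∑ j with j.val < r, inner ℝ (Z (v j)) (Δ (v j)))
      + (∑ j with ¬ j.val < r, inner ℝ (Z (v j)) (X (v j))) + hs (-Z) (A ∘ₗ Q) := by
    rw [hs_eq_sum v, hs_eq_sum v, ← Finset.sum_filter_add_sum_filter_not _ (fun j => j.val < r),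
      add_assoc]
    congr 1
    rw [← Finset.sum_filter_add_sum_filter_not (s := Finset.univ) (fun j : Fin n => j.val < r)
      (fun j => inner ℝ ((-Z) (v j)) ((A ∘ₗ Q) (v j)))]
    rw [Finset.sum_eq_zero (s := Finset.univ.filter (fun j : Fin n => j.val < r))
      (f := fun j => inner ℝ ((-Z) (v j)) ((A ∘ₗ Q) (v j))), zero_add, ← Finset.sum_add_distrib]
    · refine Finset.sum_congr rfl fun j hj => ?_
      have hj' : ¬ j.val < r := by simpa using hj
      simp only [LinearMap.comp_apply, Qv, if_neg hj', hΔ, LinearMap.sub_apply, LinearMap.neg_apply,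
        inner_sub_right, inner_neg_left]
      ring
    · intro j hj
      have hj' : j.val < r := by simpa using hj
      simp [Qv, hj']
  have hΔsum : hs Δ Δ = ∑ j, ‖Δ (v j)‖ ^ 2 := hs_self_eq_sum v Δ
  have b1 : ∑ j with j.val < r, inner ℝ (Z (v j)) (Δ (v j)) ≤ z * (√r * √(hs Δ Δ)) := by
    calc _ ≤ ∑ j with j.val < r, z * ‖Δ (v j)‖ := Finset.sum_le_sum fun j _ =>
          (real_inner_le_norm _ _).trans (mul_le_mul_of_nonneg_right (hZv j) (norm_nonneg _))
      _ = z * ∑ j with j.val < r, ‖Δ (v j)‖ := by rw [Finset.mul_sum]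
      _ ≤ _ := by
          rw [hΔsum]
          exact mul_le_mul_of_nonneg_left (sum_filter_lt_le r _) hz
  have b2 : ∑ j with ¬ j.val < r, inner ℝ (Z (v j)) (X (v j))
      ≤ z * ∑ j : Fin n with ¬ j.val < r, X.singularValues j := by
    rw [Finset.mul_sum]
    refine Finset.sum_le_sum fun j _ => (real_inner_le_norm _ _).trans ?_
    rw [hv, norm_apply_rightBasis]
    exact mul_le_mul_of_nonneg_right (hZv j) (X.singularValues_nonneg _)
  have tail : ∑ j : Fin n with ¬ j.val < r, X.singularValues j ^ 2 ≤ hs Δ Δ := by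
    refine le_trans ?_ (sum_sq_singularValues_sub_le X A hn)
    refine le_trans (le_of_eq ?_) (Finset.sum_le_univ_sum_of_nonneg
      (s := Finset.univ.filter (fun j : Fin n => ¬ j.val < r)) fun _ => sq_nonneg _)
    refine Finset.sum_congr rfl fun j hj => ?_
    have hj' : ¬ j.val < r := by simpa using hj
    rw [A.singularValues_eq_zero_iff_le_finrank_range.mpr (hr.trans (not_lt.mp hj')), sub_zero]
  -- On the tail A = X − Δ. The tail of `X` costs at most ‖Δ‖² by Mirsky, because the singular
  -- values of `A` vanish there. The factor 4 becomes 2 after the root, whence 3 = 1 + 2 in the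
  -- conclusion.
  have hAQ2 : hs (A ∘ₗ Q) (A ∘ₗ Q) ≤ 4 * hs Δ Δ := by
    have : hs (A ∘ₗ Q) (A ∘ₗ Q) ≤ ∑ j with ¬ j.val < r, (2 * ‖X (v j)‖ ^ 2 + 2 * ‖Δ (v j)‖ ^ 2) := by
      rw [hs_self_eq_sum v, Finset.sum_filter]
      refine Finset.sum_le_sum fun j _ => ?_
      by_cases hj : j.val < r
      · simp [Qv, hj]
      · simp only [LinearMap.comp_apply, Qv, hj, if_false, not_false_eq_true, if_true]
        have hA : A (v j) = X (v j) - Δ (v j) := by simp [hΔ]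
        have h3 : ‖A (v j)‖ ≤ ‖X (v j)‖ + ‖Δ (v j)‖ := by rw [hA]; exact norm_sub_le _ _
        nlinarith [sq_nonneg (‖X (v j)‖ - ‖Δ (v j)‖), norm_nonneg (A (v j))]
    rw [Finset.sum_add_distrib, ← Finset.mul_sum, ← Finset.mul_sum] at this
    have t2 : ∑ j with ¬ j.val < r, ‖Δ (v j)‖ ^ 2 ≤ hs Δ Δ := by
      rw [hΔsum]; exact Finset.sum_le_univ_sum_of_nonneg fun _ => sq_nonneg _
    have t3 : ∑ j with ¬ j.val < r, ‖X (v j)‖ ^ 2 ≤ hs Δ Δ := by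
      simpa only [hv, norm_apply_rightBasis] using tail
    linarith
  have b3 : hs (-Z) (A ∘ₗ Q) ≤ z * (√r * (2 * √(hs Δ Δ))) := by
    refine (hs_le_of_finrank_range_le hz (fun x => by simpa using hZ x) hAQ).trans ?_
    refine mul_le_mul_of_nonneg_left (mul_le_mul_of_nonneg_left ?_ (Real.sqrt_nonneg _)) hz
    refine (Real.sqrt_le_sqrt hAQ2).trans (le_of_eq ?_)
    rw [Real.sqrt_mul (by norm_num), show (4 : ℝ) = 2 ^ 2 by norm_num,
      Real.sqrt_sq (by norm_num)]
  rw [e1]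
  linarith

end SingularValues

/-! ### Matrix versions, and the variation of the penalty. -/

section MatrixSingularValues

variable {m₁ m₂ : ℕ}

theorem traceInner_eq_sum (B A : Matrix (Fin m₁) (Fin m₂) ℝ) :
    traceInner B A = ∑ k, ∑ l, B k l * A k l := by
  simp only [traceInner, Matrix.trace, Matrix.diag_apply, Matrix.mul_apply, Matrix.transpose_apply]
  exact Finset.sum_comm

theorem traceInner_single (k : Fin m₁) (l : Fin m₂) (A : Matrix (Fin m₁) (Fin m₂) ℝ) :
    traceInner (Matrix.single k l 1) A = A k l := by
  rw [traceInner_eq_sum, Finset.sum_eq_single k, Finset.sum_eq_single l]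
  · simp
  · intro j _ hj; simp [hj.symm]
  · simp
  · intro i _ hi
    exact Finset.sum_eq_zero fun j _ => by simp [hi.symm]
  · simp

theorem traceInner_eq_hs (B A : Matrix (Fin m₁) (Fin m₂) ℝ) :
    traceInner B A = hs (Matrix.toEuclideanLin B) (Matrix.toEuclideanLin A) := by
  rw [hs_eq_sum (EuclideanSpace.basisFun (Fin m₂) ℝ), traceInner_eq_sum, Finset.sum_comm]
  refine Finset.sum_congr rfl fun l _ => ?_
  simp [Matrix.toLpLin_apply, PiLp.inner_apply, mul_comm]

theorem frobNorm_nonneg (A : Matrix (Fin m₁) (Fin m₂) ℝ) : 0 ≤ frobNorm A := Real.sqrt_nonneg _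

theorem frobNorm_sq (A : Matrix (Fin m₁) (Fin m₂) ℝ) :
    frobNorm A ^ 2 = ∑ k, ∑ l, A k l ^ 2 :=
  Real.sq_sqrt (Finset.sum_nonneg fun _ _ => Finset.sum_nonneg fun _ _ => sq_nonneg _)

theorem traceInner_self (A : Matrix (Fin m₁) (Fin m₂) ℝ) : traceInner A A = frobNorm A ^ 2 := by
  rw [frobNorm_sq, traceInner_eq_sum]; simp only [sq]

theorem sqrt_hs_self (A : Matrix (Fin m₁) (Fin m₂) ℝ) :
    √(hs (Matrix.toEuclideanLin A) (Matrix.toEuclideanLin A)) = frobNorm A := by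
  rw [← traceInner_eq_hs, traceInner_self, Real.sqrt_sq (frobNorm_nonneg A)]

theorem finrank_range_toEuclideanLin (A : Matrix (Fin m₁) (Fin m₂) ℝ) :
    Module.finrank ℝ (LinearMap.range (Matrix.toEuclideanLin A)) = A.rank := by
  rw [Matrix.rank_eq_finrank_range_toLin A (EuclideanSpace.basisFun (Fin m₁) ℝ).toBasis
    (EuclideanSpace.basisFun (Fin m₂) ℝ).toBasis, ← Matrix.toEuclideanLin_eq_toLin_orthonormal]

theorem sv_nonneg (A : Matrix (Fin m₁) (Fin m₂) ℝ) (j : ℕ) : 0 ≤ sv A j :=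
  LinearMap.singularValues_nonneg _ j

theorem sv_eq_zero_of_rank_le {A : Matrix (Fin m₁) (Fin m₂) ℝ} {j : ℕ} (h : A.rank ≤ j) :
    sv A j = 0 := by
  rw [sv, LinearMap.singularValues_eq_zero_iff_le_finrank_range, finrank_range_toEuclideanLin]
  exact h

theorem frobNorm_sq_eq_sum_sv (A : Matrix (Fin m₁) (Fin m₂) ℝ) :
    frobNorm A ^ 2 = ∑ j : Fin m₂, sv A j ^ 2 := by
  rw [← traceInner_self, traceInner_eq_hs, hs_self_eq_sum_singularValues _ (n := m₂) (by simp)]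
  rfl

theorem sum_sq_sv_sub_le (A B : Matrix (Fin m₁) (Fin m₂) ℝ) :
    ∑ j : Fin m₂, (sv A j - sv B j) ^ 2 ≤ frobNorm (A - B) ^ 2 := by
  have h := sum_sq_singularValues_sub_le (Matrix.toEuclideanLin A) (Matrix.toEuclideanLin B)
    (n := m₂) (by simp)
  rwa [← map_sub, ← traceInner_eq_hs, traceInner_self] at h

theorem sv_le_frobNorm (A : Matrix (Fin m₁) (Fin m₂) ℝ) (j : ℕ) : sv A j ≤ frobNorm A := by
  by_cases hj : j < m₂
  · refine abs_le_of_sq_le_sq' ?_ (frobNorm_nonneg A) |>.2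
    rw [frobNorm_sq_eq_sum_sv]
    exact Finset.single_le_sum (f := fun i : Fin m₂ => sv A i ^ 2) (fun _ _ => sq_nonneg _)
      (Finset.mem_univ ⟨j, hj⟩)
  · rw [sv_eq_zero_of_rank_le ((Matrix.rank_le_width A).trans (not_lt.mp hj))]
    exact frobNorm_nonneg A

theorem frobNorm_le_of_maxNormLE {A : Matrix (Fin m₁) (Fin m₂) ℝ} {ζ : ℝ} (h0 : 0 ≤ ζ)
    (h : MaxNormLE A ζ) : frobNorm A ≤ ζ * √(m₁ * m₂ : ℝ) := by
  refine abs_le_of_sq_le_sq' ?_ (by positivity) |>.2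
  rw [frobNorm_sq, mul_pow, Real.sq_sqrt (by positivity)]
  calc _ ≤ ∑ _k : Fin m₁, ∑ _l : Fin m₂, ζ ^ 2 := by
        refine Finset.sum_le_sum fun k _ => Finset.sum_le_sum fun l _ => ?_
        exact sq_le_sq' (abs_le.mp (h k l)).1 (abs_le.mp (h k l)).2
    _ = _ := by simp; ring

/-- The operator results are indexed by the dimension of the domain; the extra singular values are
zero and cost no penalty. -/
theorem TL1_eq_sum_fin (a : ℝ) (A : Matrix (Fin m₁) (Fin m₂) ℝ) :
    TL1 a A = ∑ j : Fin m₂, (a + 1) * sv A j / (a + sv A j) := by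
  rw [TL1, ← Finset.sum_range (fun j => (a + 1) * sv A j / (a + sv A j))]
  refine Finset.sum_subset (Finset.range_mono (min_le_right _ _)) fun j _ hj => ?_
  have hr : A.rank ≤ j := by
    refine (le_min (Matrix.rank_le_height A) (Matrix.rank_le_width A)).trans ?_
    simpa only [Finset.mem_range, not_lt] using hj
  simp [sv_eq_zero_of_rank_le hr]

/-- The sum of all but the `r` largest singular values. -/
def svTail (A : Matrix (Fin m₁) (Fin m₂) ℝ) (r : ℕ) : ℝ := ∑ j : Fin m₂ with ¬ j.val < r, sv A j

theorem svTail_nonneg (A : Matrix (Fin m₁) (Fin m₂) ℝ) (r : ℕ) : 0 ≤ svTail A r :=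
  Finset.sum_nonneg fun _ _ => sv_nonneg _ _

/-- For indices below the rank of `A`, the Lipschitz bound is combined with Mirsky and
Cauchy–Schwarz. For the others `A` contributes nothing, and concavity leaves the penalty of `X`
above its chord on [0, s], where all its singular values lie. -/
theorem TL1_sub_le {A X : Matrix (Fin m₁) (Fin m₂) ℝ} {a s : ℝ} (ha : 0 < a)
    (hX : frobNorm X ≤ s) :
    TL1 a A - TL1 a X ≤ (1 + a) / a * (√A.rank * frobNorm (X - A))
      - (1 + a) / (a + s) * svTail X A.rank := by
  have hs0 : 0 ≤ s := (frobNorm_nonneg X).trans hX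
  have lip : ∀ x y : ℝ, 0 ≤ x → 0 ≤ y →
      (a + 1) * y / (a + y) - (a + 1) * x / (a + x) ≤ (1 + a) / a * |x - y| := by
    intro x y hx hy
    have e : (a + 1) * y / (a + y) - (a + 1) * x / (a + x)
        = (1 + a) / a * ((y - x) * (a * a / ((a + y) * (a + x)))) := by
      field_simp; ring
    rw [e]
    refine mul_le_mul_of_nonneg_left ?_ (by positivity)
    have h1 : a * a / ((a + y) * (a + x)) ≤ 1 := by
      rw [div_le_one (by positivity)]
      nlinarith [mul_nonneg hx hy, mul_nonneg ha.le hx, mul_nonneg ha.le hy]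
    have h0 : 0 ≤ a * a / ((a + y) * (a + x)) := by positivity
    calc _ ≤ |y - x| * (a * a / ((a + y) * (a + x))) :=
          mul_le_mul_of_nonneg_right (le_abs_self _) h0
      _ ≤ |y - x| * 1 := mul_le_mul_of_nonneg_left h1 (abs_nonneg _)
      _ = |x - y| := by rw [mul_one, abs_sub_comm]
  have low : ∀ j, (1 + a) / (a + s) * sv X j ≤ (a + 1) * sv X j / (a + sv X j) := by
    intro j
    have h0 := sv_nonneg X j
    have h1 := (sv_le_frobNorm X j).trans hX
    rw [div_mul_eq_mul_div, add_comm 1 a]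
    exact div_le_div_of_nonneg_left (by positivity) (by positivity) (by linarith)
  rw [TL1_eq_sum_fin, TL1_eq_sum_fin, svTail, Finset.mul_sum, Finset.sum_filter,
    ← Finset.sum_sub_distrib]
  have step : ∀ j : Fin m₂, (a + 1) * sv A j / (a + sv A j) - (a + 1) * sv X j / (a + sv X j) ≤
      (if j.val < A.rank then (1 + a) / a * |sv X j - sv A j| else 0) -
      (if ¬ j.val < A.rank then (1 + a) / (a + s) * sv X j else 0) := by
    intro j
    by_cases hj : j.val < A.rank
    · simp only [hj, if_true, not_true_eq_false, if_false, sub_zero]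
      exact lip _ _ (sv_nonneg _ _) (sv_nonneg _ _)
    · simp only [hj, if_true, not_false_eq_true, if_false]
      rw [sv_eq_zero_of_rank_le (not_lt.mp hj)]
      have := low j
      simp only [mul_zero, zero_div]
      linarith
  refine (Finset.sum_le_sum fun j _ => step j).trans ?_
  rw [Finset.sum_sub_distrib]
  refine sub_le_sub_right ?_ _
  rw [← Finset.sum_filter, ← Finset.mul_sum]
  refine mul_le_mul_of_nonneg_left ?_ (by positivity)
  refine (sum_filter_lt_le A.rank (fun j : Fin m₂ => |sv X j - sv A j|)).trans ?_
  refine mul_le_mul_of_nonneg_left ?_ (Real.sqrt_nonneg _)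
  rw [Real.sqrt_le_left (frobNorm_nonneg _)]
  simpa only [sq_abs] using sum_sq_sv_sub_le X A

/-- The operator norm of `Z` is at most `z`. -/
def OpNormLE (Z : Matrix (Fin m₁) (Fin m₂) ℝ) (z : ℝ) : Prop :=
  ∀ x, ‖Matrix.toEuclideanLin Z x‖ ≤ z * ‖x‖

theorem traceInner_sub_le {Z X A : Matrix (Fin m₁) (Fin m₂) ℝ} {z : ℝ} (hz : 0 ≤ z)
    (hZ : OpNormLE Z z) :
    traceInner Z (X - A) ≤ z * (svTail X A.rank + 3 * (√A.rank * frobNorm (X - A))) := by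
  have h := hs_sub_le (X := Matrix.toEuclideanLin X) (A := Matrix.toEuclideanLin A) hz hZ
    (n := m₂) (by simp) (finrank_range_toEuclideanLin A).le
  rw [← map_sub, sqrt_hs_self, ← traceInner_eq_hs] at h
  exact h

theorem opNormLE_frobNorm (Z : Matrix (Fin m₁) (Fin m₂) ℝ) : OpNormLE Z (frobNorm Z) := by
  intro x
  refine abs_le_of_sq_le_sq' ?_ (by have := frobNorm_nonneg Z; positivity) |>.2
  rw [mul_pow, frobNorm_sq, EuclideanSpace.norm_sq_eq, EuclideanSpace.norm_sq_eq, Finset.sum_mul]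
  refine Finset.sum_le_sum fun k _ => ?_
  simp only [Real.norm_eq_abs, sq_abs, Matrix.toLpLin_apply, Matrix.mulVec, dotProduct]
  exact Finset.sum_mul_sq_le_sq_mul_sq _ _ _

end MatrixSingularValues

/-! ### The Lie–Trotter product formula. -/

section LieTrotter

open NormedSpace Filter Topology

variable {𝔸 : Type*} [NormedRing 𝔸] [NormedAlgebra ℝ 𝔸] [CompleteSpace 𝔸] [NormOneClass 𝔸]

theorem norm_exp_le_exp_norm (x : 𝔸) : ‖exp x‖ ≤ Real.exp ‖x‖ := by
  have h := exp_series_hasSum_exp' (𝕂 := ℝ) x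
  have h2 := exp_series_hasSum_exp' (𝕂 := ℝ) ‖x‖
  rw [← congrFun Real.exp_eq_exp_ℝ] at h2
  rw [← h.tsum_eq]
  refine tsum_of_norm_bounded h2 fun n => ?_
  rw [norm_smul, norm_inv, Real.norm_natCast, smul_eq_mul]
  exact mul_le_mul_of_nonneg_left (norm_pow_le x n) (by positivity)

omit [NormedAlgebra ℝ 𝔸] [CompleteSpace 𝔸] in
theorem norm_pow_sub_pow_le_mul {P Q : 𝔸} {M : ℝ} (hM : 1 ≤ M) (hP : ‖P‖ ≤ M) (hQ : ‖Q‖ ≤ M)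
    (n : ℕ) : ‖P ^ n - Q ^ n‖ ≤ n * M ^ n * ‖P - Q‖ := by
  induction n with
  | zero => simp
  | succ n ih =>
    have e : P ^ (n + 1) - Q ^ (n + 1) = P ^ n * (P - Q) + (P ^ n - Q ^ n) * Q := by
      rw [pow_succ, pow_succ]; noncomm_ring
    have h1 : ‖P ^ n * (P - Q)‖ ≤ M ^ (n + 1) * ‖P - Q‖ := by
      refine (norm_mul_le _ _).trans (mul_le_mul_of_nonneg_right ?_ (norm_nonneg _))
      calc ‖P ^ n‖ ≤ ‖P‖ ^ n := norm_pow_le _ _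
        _ ≤ M ^ n := pow_le_pow_left₀ (norm_nonneg _) hP n
        _ ≤ M ^ (n + 1) := pow_le_pow_right₀ hM (Nat.le_succ n)
    have h2 : ‖(P ^ n - Q ^ n) * Q‖ ≤ n * M ^ n * ‖P - Q‖ * M :=
      (norm_mul_le _ _).trans (mul_le_mul ih hQ (norm_nonneg _) (by positivity))
    rw [e]
    refine (norm_add_le _ _).trans ((add_le_add h1 h2).trans (le_of_eq ?_))
    push_cast
    ring

/-- The **Lie–Trotter product formula** along powers of two. -/
theorem tendsto_exp_mul_exp_pow (A B : 𝔸) :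
    Tendsto (fun k : ℕ => (exp (((2 : ℝ) ^ k)⁻¹ • A) * exp (((2 : ℝ) ^ k)⁻¹ • B)) ^ 2 ^ k) atTop
      (𝓝 (exp (A + B))) := by
  set f : ℝ → 𝔸 := fun t => exp (t • A) * exp (t • B) - exp (t • (A + B)) with hf
  -- Both curves have the same first-order term, so `f t = o(t)`. This is what survives
  -- multiplication by the 2ᵏ factors of the telescoping estimate.
  have hder : HasDerivAt f 0 0 := by
    have h1 := ((hasDerivAt_exp_smul_const (𝕂 := ℝ) A 0).mul
      (hasDerivAt_exp_smul_const (𝕂 := ℝ) B 0)).sub (hasDerivAt_exp_smul_const (𝕂 := ℝ) (A + B) 0)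
    exact h1.congr_deriv (by simp)
  have hf0 : f 0 = 0 := by simp [hf]
  have hN : Tendsto (fun k : ℕ => ((2 : ℝ) ^ k)⁻¹) atTop (𝓝 0) :=
    tendsto_inv_atTop_zero.comp (tendsto_pow_atTop_atTop_of_one_lt one_lt_two)
  have hlim : Tendsto (fun k : ℕ => (2 : ℝ) ^ k * ‖f ((2 : ℝ) ^ k)⁻¹‖) atTop (𝓝 0) := by
    have h2 := hder.isLittleO
    simp only [sub_zero, hf0, smul_zero] at h2
    have h3 := (h2.comp_tendsto hN).norm_norm.tendsto_div_nhds_zero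
    refine h3.congr fun k => ?_
    simp only [Function.comp_apply, norm_inv, norm_pow, Real.norm_ofNat]
    rw [div_inv_eq_mul, mul_comm]
  set C := Real.exp (‖A‖ + ‖B‖) with hC
  have hbound : ∀ k : ℕ, ‖(exp (((2 : ℝ) ^ k)⁻¹ • A) * exp (((2 : ℝ) ^ k)⁻¹ • B)) ^ 2 ^ k
      - exp (A + B)‖ ≤ C * ((2 : ℝ) ^ k * ‖f ((2 : ℝ) ^ k)⁻¹‖) := by
    intro k
    set t := ((2 : ℝ) ^ k)⁻¹ with ht
    have ht0 : 0 < t := by positivity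
    set M := Real.exp (t * (‖A‖ + ‖B‖)) with hM
    have hM1 : 1 ≤ M := Real.one_le_exp (by positivity)
    have hP : ‖exp (t • A) * exp (t • B)‖ ≤ M := by
      refine (norm_mul_le _ _).trans ((mul_le_mul (norm_exp_le_exp_norm _) (norm_exp_le_exp_norm _)
        (norm_nonneg _) (Real.exp_nonneg _)).trans (le_of_eq ?_))
      rw [← Real.exp_add, norm_smul, norm_smul, Real.norm_of_nonneg ht0.le, ← mul_add]
    have hQ : ‖exp (t • (A + B))‖ ≤ M := by
      refine (norm_exp_le_exp_norm _).trans (Real.exp_le_exp.mpr ?_)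
      rw [norm_smul, Real.norm_of_nonneg ht0.le]
      exact mul_le_mul_of_nonneg_left (norm_add_le _ _) ht0.le
    have hQpow : exp (t • (A + B)) ^ 2 ^ k = exp (A + B) := by
      let _ : NormedAlgebra ℚ 𝔸 := .restrictScalars ℚ ℝ 𝔸
      rw [← exp_nsmul, ← Nat.cast_smul_eq_nsmul ℝ, smul_smul, ht]
      push_cast
      rw [mul_inv_cancel₀ (by positivity), one_smul]
    -- The growth factor of the telescoping bound does not depend on `k`.
    have hMpow : M ^ 2 ^ k = C := by
      rw [hM, ← Real.exp_nat_mul, ht]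
      push_cast
      rw [← mul_assoc, mul_inv_cancel₀ (by positivity), one_mul]
    have := norm_pow_sub_pow_le_mul hM1 hP hQ (2 ^ k)
    rw [hQpow, hMpow] at this
    refine this.trans (le_of_eq ?_)
    push_cast
    simp only [hf]
    ring
  rw [tendsto_iff_norm_sub_tendsto_zero]
  refine squeeze_zero (fun _ => norm_nonneg _) hbound ?_
  simpa using hlim.const_mul C

end LieTrotter

/-! ### The Golden–Thompson inequality. -/

section GoldenThompson

open Matrix NormedSpace Filter Topology

variable {J : Type*} [Fintype J] [DecidableEq J]

theorem trace_mul_pow_comm (A B : Matrix J J ℝ) (n : ℕ) :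
    ((A * B) ^ n).trace = ((B * A) ^ n).trace := by
  cases n with
  | zero => simp
  | succ n =>
    have h : ∀ n : ℕ, (A * B) ^ (n + 1) = A * (B * A) ^ n * B := by
      intro n
      induction n with
      | zero => simp
      | succ n ih => rw [pow_succ, ih, pow_succ]; simp only [Matrix.mul_assoc]
    rw [h, Matrix.trace_mul_comm, ← Matrix.mul_assoc, ← pow_succ']

omit [DecidableEq J] in
theorem trace_mul_le_half (A B : Matrix J J ℝ) :
    (A * B).trace ≤ ((Aᵀ * A).trace + (Bᵀ * B).trace) / 2 := by
  have e : ∀ M : Matrix J J ℝ, (Mᵀ * M).trace = ∑ i, ∑ j, M j i ^ 2 := by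
    intro M; simp [Matrix.trace, Matrix.mul_apply, sq]
  rw [e, e B, Finset.sum_comm (f := fun i j => A j i ^ 2), ← Finset.sum_add_distrib,
    Finset.sum_div]
  simp only [Matrix.trace, Matrix.mul_apply, Matrix.diag_apply]
  refine Finset.sum_le_sum fun i _ => ?_
  rw [← Finset.sum_add_distrib, Finset.sum_div]
  exact Finset.sum_le_sum fun j _ => by nlinarith [sq_nonneg (A i j - B j i)]

/-- The two statements feed each other. The first at k+1 applies the second to Z = XY, cycles the
trace to X²Y², and uses the first at k. The second at k+1 applies itself to Z², cycles to
(ZZᵀ)(ZᵀZ), uses the first at k, and ends with the arithmetic–geometric inequality. -/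
theorem trace_pow_two_pow_le (k : ℕ) :
    (∀ X Y : Matrix J J ℝ, X.IsSymm → Y.IsSymm →
      ((X * Y) ^ 2 ^ k).trace ≤ (X ^ 2 ^ k * Y ^ 2 ^ k).trace) ∧
    ∀ Z : Matrix J J ℝ, (Z ^ 2 ^ (k + 1)).trace ≤ ((Zᵀ * Z) ^ 2 ^ k).trace := by
  induction k with
  | zero =>
    refine ⟨fun X Y _ _ => by simp, fun Z => ?_⟩
    have := trace_mul_le_half Z Z
    simp only [zero_add, pow_one, pow_zero]
    rw [sq]
    linarith
  | succ k ih =>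
    obtain ⟨G, R⟩ := ih
    have hsq : ∀ (M : Matrix J J ℝ), (M ^ 2) ^ 2 ^ k = M ^ 2 ^ (k + 1) := by
      intro M; rw [← pow_mul, pow_succ' 2 k]
    refine ⟨fun X Y hX hY => ?_, fun Z => ?_⟩
    · refine (R (X * Y)).trans ?_
      rw [Matrix.transpose_mul, hX.eq, hY.eq, Matrix.mul_assoc, trace_mul_pow_comm,
        show X * (X * Y) * Y = X ^ 2 * Y ^ 2 by rw [sq, sq]; simp only [Matrix.mul_assoc]]
      refine (G (X ^ 2) (Y ^ 2) (hX.pow 2) (hY.pow 2)).trans ?_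
      rw [hsq, hsq]
    · have hX : (Z * Zᵀ).IsSymm := by simp [Matrix.IsSymm, Matrix.transpose_mul]
      have hY : (Zᵀ * Z).IsSymm := by simp [Matrix.IsSymm, Matrix.transpose_mul]
      have h1 : (Z ^ 2 ^ (k + 1 + 1)).trace ≤ (((Z * Zᵀ) * (Zᵀ * Z)) ^ 2 ^ k).trace := by
        have := R (Z ^ 2)
        rw [← pow_mul, ← pow_succ'] at this
        refine this.trans (le_of_eq ?_)
        rw [sq, Matrix.transpose_mul, show Zᵀ * Zᵀ * (Z * Z) = (Zᵀ * (Zᵀ * Z)) * Z by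
          simp only [Matrix.mul_assoc], trace_mul_pow_comm]
        simp only [Matrix.mul_assoc]
      refine h1.trans ((G _ _ hX hY).trans ((trace_mul_le_half _ _).trans ?_))
      rw [(hX.pow _).eq, (hY.pow _).eq, ← pow_add, ← pow_add, ← two_mul, ← pow_succ',
        trace_mul_pow_comm Z Zᵀ]
      linarith

/-- The **Golden–Thompson inequality** for real symmetric matrices. -/
theorem trace_exp_add_le [Nonempty J] {A B : Matrix J J ℝ} (hA : A.IsSymm) (hB : B.IsSymm) :
    (exp (A + B)).trace ≤ (exp A * exp B).trace := by
  let _ : NormedRing (Matrix J J ℝ) := Matrix.linftyOpNormedRing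
  let _ : NormedAlgebra ℝ (Matrix J J ℝ) := Matrix.linftyOpNormedAlgebra
  have : NormOneClass (Matrix J J ℝ) := Matrix.linfty_opNormOneClass
  let _ : NormedAlgebra ℚ (Matrix J J ℝ) := .restrictScalars ℚ ℝ _
  have h := tendsto_exp_mul_exp_pow A B
  have ht : Continuous (fun M : Matrix J J ℝ => M.trace) := continuous_id.matrix_trace
  refine le_of_tendsto ((ht.tendsto _).comp h) (Eventually.of_forall fun k => ?_)
  have hpow : ∀ M : Matrix J J ℝ, exp (((2 : ℝ) ^ k)⁻¹ • M) ^ 2 ^ k = exp M := by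
    intro M
    rw [← Matrix.exp_nsmul, ← Nat.cast_smul_eq_nsmul ℝ, smul_smul]
    push_cast
    rw [mul_inv_cancel₀ (by positivity), one_smul]
  -- The right side is already tr(eᴬeᴮ) for every `k`, while the left side tends to tr(e^(A+B)).
  have := (trace_pow_two_pow_le k).1 (exp (((2 : ℝ) ^ k)⁻¹ • A)) (exp (((2 : ℝ) ^ k)⁻¹ • B))
    (hA.smul _).exp (hB.smul _).exp
  rw [hpow, hpow] at this
  exact this

end GoldenThompson

/-! ### Closed forms and positivity of matrix exponentials. -/

section MatrixExponential

open Matrix NormedSpace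

variable {J : Type*} [Fintype J] [DecidableEq J]

theorem continuous_trace_exp : Continuous fun M : Matrix J J ℝ => (exp M).trace := by
  let _ : NormedRing (Matrix J J ℝ) := Matrix.linftyOpNormedRing
  let _ : NormedAlgebra ℝ (Matrix J J ℝ) := Matrix.linftyOpNormedAlgebra
  let _ : NormedAlgebra ℚ (Matrix J J ℝ) := .restrictScalars ℚ ℝ _
  have : Continuous (exp : Matrix J J ℝ → Matrix J J ℝ) := exp_continuous
  exact this.matrix_trace

theorem exp_smul_of_idempotent {p : Matrix J J ℝ} (hp : p * p = p) (t : ℝ) :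
    exp (t • p) = 1 + (Real.exp t - 1) • p := by
  let _ : NormedRing (Matrix J J ℝ) := Matrix.linftyOpNormedRing
  let _ : NormedAlgebra ℝ (Matrix J J ℝ) := Matrix.linftyOpNormedAlgebra
  have hpow : ∀ n, p ^ (n + 1) = p := by
    intro n
    induction n with
    | zero => simp
    | succ n ih => rw [pow_succ, ih, hp]
  have h1 := exp_series_hasSum_exp' (𝕂 := ℝ) (t • p)
  have h2 := exp_series_hasSum_exp' (𝕂 := ℝ) t
  rw [← congrFun Real.exp_eq_exp_ℝ] at h2
  -- All powers equal `p` except the zeroth, which is 1; the extra term 1 − p corrects this.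
  have h3 := (h2.smul_const p).add (hasSum_ite_eq 0 (1 - p))
  rw [show 1 + (Real.exp t - 1) • p = Real.exp t • p + (1 - p) by rw [sub_smul, one_smul]; abel]
  refine h1.unique (h3.congr_fun ?_)
  intro n
  cases n with
  | zero => simp
  | succ n => simp [smul_pow, hpow, smul_smul]

/-- The identity E³ = E splits `E` as p − m with complementary spectral idempotents p = (E²+E)/2 and
m = (E²−E)/2, which annihilate each other. -/
theorem exp_smul_of_cube_eq {E : Matrix J J ℝ} (hE : E * E * E = E) (t : ℝ) :
    exp (t • E) = 1 + (Real.cosh t - 1) • (E * E) + Real.sinh t • E := by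
  let _ : NormedRing (Matrix J J ℝ) := Matrix.linftyOpNormedRing
  let _ : NormedAlgebra ℝ (Matrix J J ℝ) := Matrix.linftyOpNormedAlgebra
  have hE4 : E * E * (E * E) = E * E := by
    rw [← Matrix.mul_assoc, hE]
  have hE' : E * (E * E) = E := by rw [← Matrix.mul_assoc, hE]
  set p : Matrix J J ℝ := (1 / 2 : ℝ) • (E * E + E) with hp
  set m : Matrix J J ℝ := (1 / 2 : ℝ) • (E * E - E) with hm
  have hpp : p * p = p := by
    simp only [hp, smul_mul_smul_comm, mul_add, add_mul, hE4, hE', hE]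
    module
  have hmm : m * m = m := by
    simp only [hm, smul_mul_smul_comm, mul_sub, sub_mul, hE4, hE', hE]
    module
  have hpm : p * m = 0 := by
    simp only [hp, hm, smul_mul_smul_comm, mul_sub, add_mul, hE4, hE', hE]
    module
  have hmp : m * p = 0 := by
    simp only [hp, hm, smul_mul_smul_comm, mul_add, sub_mul, hE4, hE', hE]
    module
  have hcomm : Commute (t • p) ((-t) • m) := by
    simp [Commute, SemiconjBy, hpm, hmp]
  rw [show t • E = t • p + (-t) • m by simp only [hp, hm]; module,
    Matrix.exp_add_of_commute _ _ hcomm, exp_smul_of_idempotent hpp, exp_smul_of_idempotent hmm]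
  rw [mul_add, mul_one, add_mul, smul_mul_smul_comm, hpm, one_mul, smul_zero, add_zero,
    Real.cosh_eq, Real.sinh_eq, hp, hm]
  module

theorem exp_eq_transpose_mul_self {B : Matrix J J ℝ} (hB : B.IsSymm) :
    ∃ C : Matrix J J ℝ, exp B = Cᵀ * C := by
  refine ⟨exp ((1 / 2 : ℝ) • B), ?_⟩
  have hC : (exp ((1 / 2 : ℝ) • B)).IsSymm := (hB.smul _).exp
  rw [hC.eq, ← Matrix.exp_add_of_commute _ _ (Commute.refl _), ← add_smul]
  norm_num

/-- `exp B` is a Gram matrix CᵀC; the claim is positivity of its quadratic form at eᵢ ± eⱼ. -/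
theorem abs_exp_apply_add_le {B : Matrix J J ℝ} (hB : B.IsSymm) (i j : J) :
    |exp B i j + exp B j i| ≤ exp B i i + exp B j j := by
  obtain ⟨C, hC⟩ := exp_eq_transpose_mul_self hB
  simp only [hC, Matrix.mul_apply, Matrix.transpose_apply, ← Finset.sum_add_distrib]
  refine (Finset.abs_sum_le_sum_abs _ _).trans (Finset.sum_le_sum fun k _ => ?_)
  rw [abs_le]
  constructor <;> nlinarith [sq_nonneg (C k i - C k j), sq_nonneg (C k i + C k j)]

theorem exp_apply_self_nonneg {B : Matrix J J ℝ} (hB : B.IsSymm) (i : J) : 0 ≤ exp B i i := by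
  have := (abs_nonneg _).trans (abs_exp_apply_add_le hB i i)
  linarith

theorem trace_exp_nonneg {B : Matrix J J ℝ} (hB : B.IsSymm) : 0 ≤ (exp B).trace :=
  Finset.sum_nonneg fun i _ => exp_apply_self_nonneg hB i

/-- A Rayleigh quotient is a convex combination of eigenvalues, hence below one of them, and the
trace is a sum of positive exponentials that includes that one. -/
theorem exp_dotProduct_mulVec_le {A : Matrix J J ℝ} (hA : A.IsSymm) {x : J → ℝ}
    (hx : x ⬝ᵥ x = 1) : Real.exp (x ⬝ᵥ A *ᵥ x) ≤ (exp A).trace := by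
  have hH : A.IsHermitian := by
    rw [Matrix.IsHermitian, Matrix.conjTranspose_eq_transpose_of_trivial]; exact hA
  set U : Matrix J J ℝ := (hH.eigenvectorUnitary : Matrix J J ℝ) with hU
  have hUU : star U * U = 1 := Unitary.coe_star_mul_self hH.eigenvectorUnitary
  have hUU' : U * star U = 1 := Unitary.coe_mul_star_self hH.eigenvectorUnitary
  have hinv : U⁻¹ = star U := Matrix.inv_eq_left_inv hUU
  have hunit : IsUnit U := ⟨⟨U, star U, hUU', hUU⟩, rfl⟩
  have hspec : A = U * diagonal hH.eigenvalues * U⁻¹ := by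
    conv_lhs => rw [hH.spectral_theorem, Unitary.conjStarAlgAut_apply]
    rw [hinv]; rfl
  have htr : (exp A).trace = ∑ i, Real.exp (hH.eigenvalues i) := by
    conv_lhs => rw [hspec]
    rw [Matrix.exp_conj _ _ hunit, Matrix.trace_mul_comm, ← Matrix.mul_assoc, hinv, hUU,
      Matrix.one_mul, Matrix.exp_diagonal, Matrix.trace_diagonal]
    refine Finset.sum_congr rfl fun i _ => ?_
    rw [Pi.coe_exp, congrFun Real.exp_eq_exp_ℝ]
  set y := star U *ᵥ x with hy
  have hyU : x ᵥ* U = y := by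
    rw [hy, ← Matrix.vecMul_transpose]
    rw [Matrix.star_eq_conjTranspose, Matrix.conjTranspose_eq_transpose_of_trivial,
      Matrix.transpose_transpose]
  have hquad : x ⬝ᵥ A *ᵥ x = ∑ i, hH.eigenvalues i * y i ^ 2 := by
    conv_lhs => rw [hspec, hinv]
    rw [← Matrix.mulVec_mulVec, ← Matrix.mulVec_mulVec, Matrix.dotProduct_mulVec, hyU, ← hy]
    simp only [dotProduct, Matrix.mulVec_diagonal]
    exact Finset.sum_congr rfl fun i _ => by ring
  have hnorm : ∑ i, y i ^ 2 = 1 := by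
    have : y ⬝ᵥ y = 1 := by
      nth_rw 1 [← hyU]
      rw [hy, ← Matrix.dotProduct_mulVec, Matrix.mulVec_mulVec, hUU', Matrix.one_mulVec, hx]
    simpa [dotProduct, sq] using this
  have hex : ∃ i, x ⬝ᵥ A *ᵥ x ≤ hH.eigenvalues i := by
    by_contra! hcon
    have hlt : ∑ i, hH.eigenvalues i * y i ^ 2 < ∑ i, (x ⬝ᵥ A *ᵥ x) * y i ^ 2 := by
      have hpos : ∃ i, 0 < y i ^ 2 := by
        by_contra! hz
        have : ∑ i, y i ^ 2 ≤ 0 := Finset.sum_nonpos fun i _ => hz i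
        linarith
      obtain ⟨i, hi⟩ := hpos
      exact Finset.sum_lt_sum (fun j _ => mul_le_mul_of_nonneg_right (hcon j).le (sq_nonneg _))
        ⟨i, Finset.mem_univ i, mul_lt_mul_of_pos_right (hcon i) hi⟩
    rw [← hquad, ← Finset.mul_sum, hnorm, mul_one] at hlt
    exact lt_irrefl _ hlt
  obtain ⟨i, hi⟩ := hex
  rw [htr]
  exact (Real.exp_le_exp.mpr hi).trans
    (Finset.single_le_sum (f := fun i => Real.exp (hH.eigenvalues i))
      (fun i _ => (Real.exp_pos _).le) (Finset.mem_univ i))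

end MatrixExponential

/-! ### Symmetric dilations of indicator matrices. -/

section Dilation

open Matrix NormedSpace

variable {m₁ m₂ : ℕ}

/-- The symmetric dilation `[[0, M], [Mᵀ, 0]]`. -/
def dil : Matrix (Fin m₁) (Fin m₂) ℝ →ₗ[ℝ] Matrix (Fin m₁ ⊕ Fin m₂) (Fin m₁ ⊕ Fin m₂) ℝ where
  toFun M := Matrix.fromBlocks 0 M Mᵀ 0
  map_add' M N := by simp [Matrix.fromBlocks_add]
  map_smul' c M := by simp [Matrix.fromBlocks_smul]

theorem dil_apply (M : Matrix (Fin m₁) (Fin m₂) ℝ) : dil M = Matrix.fromBlocks 0 M Mᵀ 0 := rfl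

theorem dil_isSymm (M : Matrix (Fin m₁) (Fin m₂) ℝ) : (dil M).IsSymm := by
  simp [dil_apply, Matrix.IsSymm, Matrix.fromBlocks_transpose]

theorem dil_single (k : Fin m₁) (l : Fin m₂) :
    dil (Matrix.single k l 1) = Matrix.single (Sum.inl k) (Sum.inr l) 1
      + Matrix.single (Sum.inr l) (Sum.inl k) 1 := by
  ext i j
  rcases i with i | i <;> rcases j with j | j <;>
    simp [dil_apply, Matrix.single_apply, and_comm]

theorem dil_single_mul_self (k : Fin m₁) (l : Fin m₂) :
    dil (Matrix.single k l 1) * dil (Matrix.single k l 1)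
      = Matrix.single (Sum.inl k) (Sum.inl k) 1 + Matrix.single (Sum.inr l) (Sum.inr l) 1 := by
  rw [dil_single]
  simp [mul_add, add_mul, add_comm]

theorem dil_single_cube (k : Fin m₁) (l : Fin m₂) :
    dil (Matrix.single k l 1) * dil (Matrix.single k l 1) * dil (Matrix.single k l 1)
      = dil (Matrix.single k l (1 : ℝ)) := by
  rw [dil_single_mul_self, dil_single]
  simp [mul_add, add_mul]

/-- After Golden–Thompson, the exponential of the dilated indicator involves only four entries, so
the trace is explicit in two diagonal and two off-diagonal entries of `exp B`. -/
theorem trace_exp_add_dil_single_le {B : Matrix (Fin m₁ ⊕ Fin m₂) (Fin m₁ ⊕ Fin m₂) ℝ}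
    (hB : B.IsSymm) (k : Fin m₁) (l : Fin m₂) (s : ℝ) :
    (exp (B + s • dil (Matrix.single k l 1))).trace ≤ (exp B).trace
      + (Real.cosh s - 1) * (exp B (Sum.inl k) (Sum.inl k) + exp B (Sum.inr l) (Sum.inr l))
      + Real.sinh s * (exp B (Sum.inl k) (Sum.inr l) + exp B (Sum.inr l) (Sum.inl k)) := by
  have : Nonempty (Fin m₁ ⊕ Fin m₂) := ⟨Sum.inl k⟩
  refine (trace_exp_add_le hB ((dil_isSymm _).smul s)).trans (le_of_eq ?_)
  rw [exp_smul_of_cube_eq (dil_single_cube k l), dil_single_mul_self, dil_single]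
  simp only [mul_add, Matrix.mul_smul, Matrix.trace_add, Matrix.trace_smul,
    Matrix.trace_mul_single, MulOpposite.op_one, one_smul, smul_eq_mul, mul_one]
  ring

/-- The test vector is (Mx/‖Mx‖, x/‖x‖)/√2. It is a unit vector at which the quadratic form of the
dilation equals ‖Mx‖/‖x‖. -/
theorem opNormLE_of_trace_exp_le {M : Matrix (Fin m₁) (Fin m₂) ℝ} {θ t : ℝ} (hθ : 0 < θ)
    (ht : 0 ≤ t) (h : (exp (θ • dil M)).trace ≤ Real.exp (θ * t)) : OpNormLE M t := by
  intro x
  by_cases hx : x = 0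
  · simp [hx]
  by_cases hy : Matrix.toEuclideanLin M x = 0
  · rw [hy, norm_zero]; positivity
  set y := Matrix.toEuclideanLin M x with hyd
  have hx0 : 0 < ‖x‖ := norm_pos_iff.mpr hx
  have hy0 : 0 < ‖y‖ := norm_pos_iff.mpr hy
  have hxx : x.ofLp ⬝ᵥ x.ofLp = ‖x‖ ^ 2 := by
    rw [EuclideanSpace.real_norm_sq_eq]; simp [dotProduct, sq]
  have hyy : y.ofLp ⬝ᵥ y.ofLp = ‖y‖ ^ 2 := by
    rw [EuclideanSpace.real_norm_sq_eq]; simp [dotProduct, sq]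
  have hMx : M *ᵥ x.ofLp = y.ofLp := by rw [hyd, Matrix.toLpLin_apply]
  have hs2 : (√2 : ℝ) ^ 2 = 2 := Real.sq_sqrt (by norm_num)
  set w : Fin m₁ ⊕ Fin m₂ → ℝ :=
    Sum.elim ((1 / (√2 * ‖y‖)) • y.ofLp) ((1 / (√2 * ‖x‖)) • x.ofLp) with hw
  have hw1 : w ⬝ᵥ w = 1 := by
    rw [hw, sumElim_dotProduct_sumElim]
    simp only [smul_dotProduct, dotProduct_smul, hxx, hyy, smul_eq_mul]
    field_simp
    rw [hs2]; norm_num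
  have hq : w ⬝ᵥ (θ • dil M) *ᵥ w = θ * (‖y‖ / ‖x‖) := by
    rw [Matrix.smul_mulVec, dotProduct_smul, hw, dil_apply, Matrix.fromBlocks_mulVec,
      sumElim_dotProduct_sumElim]
    simp only [Sum.elim_comp_inl, Sum.elim_comp_inr, Matrix.zero_mulVec, zero_add, add_zero,
      Matrix.mulVec_smul, hMx, smul_dotProduct, dotProduct_smul, smul_zero, hyy, smul_eq_mul]
    rw [Matrix.mulVec_transpose, dotProduct_comm x.ofLp, ← Matrix.dotProduct_mulVec, hMx, hyy]
    field_simp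
    rw [hs2]; ring
  have h1 := (exp_dotProduct_mulVec_le ((dil_isSymm M).smul θ) hw1).trans h
  rw [hq, Real.exp_le_exp] at h1
  have h2 := le_of_mul_le_mul_left h1 hθ
  rwa [div_le_iff₀ hx0] at h2

end Dilation

/-! ### The matrix Laplace transform for independent positions and weights. -/

section Laplace

open Matrix NormedSpace

theorem lintegral_pi_succ {α : Type*} [MeasurableSpace α] {n : ℕ} (P : Fin (n + 1) → Measure α)
    [∀ i, SigmaFinite (P i)] {f : (Fin (n + 1) → α) → ENNReal} (hf : Measurable f) :
    ∫⁻ x, f x ∂Measure.pi P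
      = ∫⁻ a, ∫⁻ y, f (Fin.cons a y) ∂Measure.pi (fun i : Fin n => P i.succ) ∂P 0 := by
  have h := (measurePreserving_piFinSuccAbove P 0).symm
  rw [← h.lintegral_comp hf]
  refine (lintegral_prod _ (hf.comp (MeasurableEquiv.measurable _)).aemeasurable).trans ?_
  simp [MeasurableEquiv.piFinSuccAbove, Fin.insertNthEquiv, Fin.insertNth_zero']

variable {m₁ m₂ : ℕ}

/-- The law of the random position `(k, l)`. -/
def posLaw (π : Matrix (Fin m₁) (Fin m₂) ℝ) : Measure (Fin m₁ × Fin m₂) :=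
  ∑ k, ∑ l, ENNReal.ofReal (π k l) • Measure.dirac (k, l)

theorem lintegral_posLaw (π : Matrix (Fin m₁) (Fin m₂) ℝ) (f : Fin m₁ × Fin m₂ → ENNReal) :
    ∫⁻ p, f p ∂posLaw π = ∑ k, ∑ l, ENNReal.ofReal (π k l) * f (k, l) := by
  simp [posLaw, lintegral_finsetSum_measure]

theorem isProbabilityMeasure_posLaw {π : Matrix (Fin m₁) (Fin m₂) ℝ} (hπ : IsDistribution π) :
    IsProbabilityMeasure (posLaw π) := by
  constructor
  have h := lintegral_posLaw π 1
  simp only [Pi.one_apply, lintegral_one, mul_one] at h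
  rw [h]
  simp_rw [← ENNReal.ofReal_sum_of_nonneg (fun l _ => hπ.nonneg _ l)]
  rw [← ENNReal.ofReal_sum_of_nonneg (fun k _ => Finset.sum_nonneg fun l _ => hπ.nonneg k l),
    hπ.sum_eq_one, ENNReal.ofReal_one]

/-- The indicator matrix of a position. -/
def posMatrix (p : Fin m₁ × Fin m₂) : Matrix (Fin m₁) (Fin m₂) ℝ := Matrix.single p.1 p.2 1

theorem map_posMatrix_posLaw (π : Matrix (Fin m₁) (Fin m₂) ℝ) :
    (posLaw π).map posMatrix = indicatorLaw π := by
  ext s hs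
  rw [Measure.map_apply (measurable_of_finite _) hs]
  simp only [posLaw, indicatorLaw, Measure.coe_finsetSum, Finset.sum_apply, Measure.smul_apply,
    smul_eq_mul]
  refine Finset.sum_congr rfl fun k _ => Finset.sum_congr rfl fun l _ => ?_
  rw [Measure.dirac_apply' _ hs, Measure.dirac_apply]
  rfl

/-- One step of the matrix Laplace transform bound: the position has law `posLaw π` and is
independent of the real weight `η`. -/
theorem lintegral_trace_exp_add_le {π : Matrix (Fin m₁) (Fin m₂) ℝ} (hπ : IsDistribution π)
    {q : ℝ} (hrow : ∀ k, ∑ l, π k l ≤ q) (hcol : ∀ l, ∑ k, π k l ≤ q)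
    {S : Type*} [MeasurableSpace S] {ρ : Measure S} [IsProbabilityMeasure ρ] {η : S → ℝ}
    (hη : Measurable η) (hcosh : Integrable (fun s => Real.cosh (η s)) ρ)
    (hsinh : Integrable (fun s => Real.sinh (η s)) ρ) {a b : ℝ}
    (ha : ∫ s, (Real.cosh (η s) - 1) ∂ρ ≤ a) (hb : |∫ s, Real.sinh (η s) ∂ρ| ≤ b)
    {B : Matrix (Fin m₁ ⊕ Fin m₂) (Fin m₁ ⊕ Fin m₂) ℝ} (hB : B.IsSymm) :
    ∫⁻ z, ENNReal.ofReal (exp (B + η z.2 • dil (posMatrix z.1))).trace ∂(posLaw π).prod ρ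
      ≤ ENNReal.ofReal (1 + q * (a + b)) * ENNReal.ofReal (exp B).trace := by
  have ha0 : 0 ≤ a := le_trans (integral_nonneg fun s => by
    have := Real.one_le_cosh (η s); simp only [Pi.zero_apply]; linarith) ha
  have hb0 : 0 ≤ b := (abs_nonneg _).trans hb
  have hmeas : Measurable fun z : (Fin m₁ × Fin m₂) × S =>
      ENNReal.ofReal (exp (B + η z.2 • dil (posMatrix z.1))).trace := by
    refine measurable_from_prod_countable_right fun p => ?_
    have hc : Continuous fun s : ℝ => (exp (B + s • dil (posMatrix p))).trace :=
      continuous_trace_exp.comp (by fun_prop)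
    exact (hc.measurable.comp hη).ennreal_ofReal
  rw [lintegral_prod _ hmeas.aemeasurable, lintegral_posLaw]
  set W := exp B with hW
  set α : Fin m₁ → Fin m₂ → ℝ := fun k l => W (Sum.inl k) (Sum.inl k) + W (Sum.inr l) (Sum.inr l)
  set β : Fin m₁ → Fin m₂ → ℝ := fun k l => W (Sum.inl k) (Sum.inr l) + W (Sum.inr l) (Sum.inl k)
  have hα0 : ∀ k l, 0 ≤ α k l := fun k l =>
    add_nonneg (exp_apply_self_nonneg hB _) (exp_apply_self_nonneg hB _)
  have hβ : ∀ k l, |β k l| ≤ α k l := fun k l => abs_exp_apply_add_le hB _ _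
  have hstep : ∀ k l, ∫⁻ s, ENNReal.ofReal (exp (B + η s • dil (posMatrix (k, l)))).trace ∂ρ
      ≤ ENNReal.ofReal (W.trace + (a + b) * α k l) := by
    intro k l
    set g : S → ℝ := fun s => W.trace + (Real.cosh (η s) - 1) * α k l + Real.sinh (η s) * β k l
    have hle : ∀ s, (exp (B + η s • dil (posMatrix (k, l)))).trace ≤ g s := fun s =>
      trace_exp_add_dil_single_le hB k l (η s)
    have hcosh1 : Integrable (fun s => Real.cosh (η s) - 1) ρ := hcosh.sub (integrable_const 1)
    have hint1 : Integrable (fun s => W.trace + (Real.cosh (η s) - 1) * α k l) ρ :=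
      (integrable_const _).add (hcosh1.mul_const _)
    have hint2 : Integrable (fun s => Real.sinh (η s) * β k l) ρ := hsinh.mul_const _
    have hg0 : ∀ s, 0 ≤ g s := fun s =>
      (trace_exp_nonneg (hB.add ((dil_isSymm _).smul _))).trans (hle s)
    calc _ ≤ ∫⁻ s, ENNReal.ofReal (g s) ∂ρ :=
          lintegral_mono fun s => ENNReal.ofReal_le_ofReal (hle s)
      _ = ENNReal.ofReal (∫ s, g s ∂ρ) :=
          (ofReal_integral_eq_lintegral_ofReal (hint1.add hint2) (ae_of_all _ hg0)).symm
      _ ≤ _ := by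
          refine ENNReal.ofReal_le_ofReal ?_
          rw [integral_add hint1 hint2, integral_add (integrable_const _) (hcosh1.mul_const _),
            integral_mul_const, integral_mul_const, integral_const]
          simp only [probReal_univ, one_smul]
          have h1 := mul_le_mul_of_nonneg_right ha (hα0 k l)
          have h2 : (∫ s, Real.sinh (η s) ∂ρ) * β k l ≤ b * α k l := by
            refine (le_abs_self _).trans ?_
            rw [abs_mul]
            exact mul_le_mul hb (hβ k l) (abs_nonneg _) hb0
          linarith
  -- Averaging over positions weights each diagonal entry of `exp B` by a row or column marginal, so
  -- the cost is at most `q` times the trace. This is where the marginal assumption enters.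
  have hα : ∑ k, ∑ l, π k l * α k l ≤ q * W.trace := by
    have htr : W.trace = ∑ k, W (Sum.inl k) (Sum.inl k) + ∑ l, W (Sum.inr l) (Sum.inr l) := by
      simp [Matrix.trace, Fintype.sum_sum_type]
    simp only [α, mul_add, Finset.sum_add_distrib, htr, Finset.mul_sum]
    refine add_le_add ?_ ?_
    · refine Finset.sum_le_sum fun k _ => ?_
      rw [← Finset.sum_mul]
      exact mul_le_mul_of_nonneg_right (hrow k) (exp_apply_self_nonneg hB _)
    · rw [Finset.sum_comm]
      refine Finset.sum_le_sum fun l _ => ?_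
      rw [← Finset.sum_mul]
      exact mul_le_mul_of_nonneg_right (hcol l) (exp_apply_self_nonneg hB _)
  have htr0 : 0 ≤ W.trace := trace_exp_nonneg hB
  have hterm : ∀ k l, 0 ≤ π k l * (W.trace + (a + b) * α k l) := fun k l =>
    mul_nonneg (hπ.nonneg k l) (by have := hα0 k l; positivity)
  calc _ ≤ ∑ k, ∑ l, ENNReal.ofReal (π k l) * ENNReal.ofReal (W.trace + (a + b) * α k l) :=
        Finset.sum_le_sum fun k _ => Finset.sum_le_sum fun l _ => mul_le_mul_right (hstep k l) _
    _ = ENNReal.ofReal (∑ k, ∑ l, π k l * (W.trace + (a + b) * α k l)) := by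
        simp_rw [← ENNReal.ofReal_mul (hπ.nonneg _ _)]
        rw [ENNReal.ofReal_sum_of_nonneg fun k _ => Finset.sum_nonneg fun l _ => hterm k l]
        refine Finset.sum_congr rfl fun k _ => ?_
        rw [ENNReal.ofReal_sum_of_nonneg fun l _ => hterm k l]
    _ ≤ ENNReal.ofReal ((1 + q * (a + b)) * W.trace) := by
        refine ENNReal.ofReal_le_ofReal ?_
        have e : ∑ k, ∑ l, π k l * (W.trace + (a + b) * α k l)
            = W.trace + (a + b) * ∑ k, ∑ l, π k l * α k l := by
          simp only [mul_add, Finset.sum_add_distrib, ← Finset.sum_mul, hπ.sum_eq_one, one_mul,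
            Finset.mul_sum]
          congr 1
          exact Finset.sum_congr rfl fun k _ => Finset.sum_congr rfl fun l _ => by ring
        rw [e]
        have := mul_le_mul_of_nonneg_left hα (add_nonneg ha0 hb0)
        linarith
    _ = _ := ENNReal.ofReal_mul' htr0

/-- **Matrix Laplace transform bound** for sums of independent random symmetric matrices. -/
theorem lintegral_trace_exp_sum_le {J : Type*} [Fintype J] [DecidableEq J] {E : Type*}
    [MeasurableSpace E] {X : E → Matrix J J ℝ} (hX : ∀ i j, Measurable fun e => X e i j)
    (hsymm : ∀ e, (X e).IsSymm) {c : ENNReal} {n : ℕ} {P : Fin n → Measure E}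
    [∀ i, SigmaFinite (P i)]
    (hstep : ∀ i, ∀ B : Matrix J J ℝ, B.IsSymm →
      ∫⁻ e, ENNReal.ofReal (exp (B + X e)).trace ∂P i ≤ c * ENNReal.ofReal (exp B).trace)
    {B : Matrix J J ℝ} (hB : B.IsSymm) :
    ∫⁻ e, ENNReal.ofReal (exp (B + ∑ i, X (e i))).trace ∂Measure.pi P
      ≤ c ^ n * ENNReal.ofReal (exp B).trace := by
  have hmeas : ∀ n (B : Matrix J J ℝ), Measurable fun e : Fin n → E =>
      ENNReal.ofReal (exp (B + ∑ i, X (e i))).trace := by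
    intro n B
    have h1 : Measurable fun e : Fin n → E => fun (i j : J) => (B + ∑ k, X (e k)) i j := by
      refine measurable_pi_lambda _ fun i => measurable_pi_lambda _ fun j => ?_
      simp only [Matrix.add_apply, Matrix.sum_apply]
      exact measurable_const.add
        (Finset.measurable_fun_sum _ fun k _ => (hX i j).comp (measurable_pi_apply k))
    have h2 : Continuous fun M : J → J → ℝ => (exp (Matrix.of M)).trace :=
      continuous_trace_exp.comp continuous_id
    exact (h2.measurable.comp h1).ennreal_ofReal
  induction n generalizing B with
  | zero => simp
  | succ n ih =>
    rw [lintegral_pi_succ P (hmeas (n + 1) B)]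
    -- Given the first summand, the others are integrated with `B + X a` as base point; this is why
    -- the induction generalizes over `B`.
    calc _ ≤ ∫⁻ a, c ^ n * ENNReal.ofReal (exp (B + X a)).trace ∂P 0 := by
          refine lintegral_mono fun a => ?_
          have := ih (P := fun i => P i.succ) (fun i => hstep i.succ) (hB.add (hsymm a))
          simpa only [Fin.sum_univ_succ, Fin.cons_zero, Fin.cons_succ, ← add_assoc] using this
      _ = c ^ n * ∫⁻ a, ENNReal.ofReal (exp (B + X a)).trace ∂P 0 := by
          refine lintegral_const_mul _ ?_
          have h := (hmeas 1 B).comp (measurable_pi_lambda (fun (a : E) (_ : Fin 1) => a)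
            fun _ => measurable_id)
          simpa [Function.comp_def] using h
      _ ≤ c ^ n * (c * ENNReal.ofReal (exp B).trace) := mul_le_mul_right (hstep 0 B hB) _
      _ = _ := by rw [← mul_assoc, pow_succ]

end Laplace

/-! ### Contraction for exponential suprema. -/

section Contraction

/-- Weak majorization for an increasing convex function: if q' < q, the loss is paid by the gain at
the larger exponent, where the slope is larger. -/
theorem exp_add_exp_le_of_le {p q p' q' : ℝ} (hqp : q ≤ p) (hp : p ≤ p')
    (hsum : p + q ≤ p' + q') : Real.exp p + Real.exp q ≤ Real.exp p' + Real.exp q' := by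
  rcases le_total q q' with h | h
  · exact add_le_add (Real.exp_le_exp.mpr hp) (Real.exp_le_exp.mpr h)
  · have h1 : Real.exp p * (p' - p) ≤ Real.exp p' - Real.exp p := by
      have := Real.add_one_le_exp (p' - p)
      have h2 : Real.exp p' = Real.exp p * Real.exp (p' - p) := by rw [← Real.exp_add]; ring_nf
      rw [h2]; nlinarith [Real.exp_pos p]
    have h2 : Real.exp q - Real.exp q' ≤ Real.exp q * (q - q') := by
      have := Real.add_one_le_exp (q' - q)
      have h2 : Real.exp q' = Real.exp q * Real.exp (q' - q) := by rw [← Real.exp_add]; ring_nf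
      rw [h2]; nlinarith [Real.exp_pos q]
    have h3 : Real.exp q * (q - q') ≤ Real.exp p * (p' - p) :=
      mul_le_mul (Real.exp_le_exp.mpr hqp) (by linarith) (by linarith) (Real.exp_pos _).le
    linarith

/-- Depending on the sign of x and the order of the exponents, one of the three assumed pairs has an
exponent at least `a + f` and at least the same sum, so it weakly majorizes the pair in question. -/
theorem exp_add_exp_le_of_ge {a b x y f g S : ℝ} (hf : |f| ≤ |x|) (hfg : |f - g| ≤ |x - y|)
    (hord : b - g ≤ a + f)
    (h1 : Real.exp (a + x) + Real.exp (b - y) ≤ S) (h2 : Real.exp (b + y) + Real.exp (a - x) ≤ S)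
    (h3 : Real.exp (a + x) + Real.exp (a - x) ≤ S) :
    Real.exp (a + f) + Real.exp (b - g) ≤ S := by
  obtain ⟨k1, k2⟩ := abs_le.mp hf
  obtain ⟨k3, k4⟩ := abs_le.mp hfg
  rcases le_total 0 x with hx | hx
  · rw [abs_of_nonneg hx] at k1 k2
    rcases le_total y x with hyx | hyx
    · rw [abs_of_nonneg (by linarith)] at k3 k4
      exact (exp_add_exp_le_of_le hord (by linarith) (by linarith)).trans h1
    · rw [abs_of_nonpos (by linarith)] at k3 k4
      rcases le_total (a + f) (b + y) with h | h
      · exact (exp_add_exp_le_of_le hord h (by linarith)).trans h2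
      · exact (exp_add_exp_le_of_le hord (by linarith) (by linarith)).trans h3
  · rw [abs_of_nonpos hx] at k1 k2
    rcases le_total x y with hyx | hyx
    · rw [abs_of_nonpos (by linarith)] at k3 k4
      rw [add_comm] at h2
      exact (exp_add_exp_le_of_le hord (by linarith) (by linarith)).trans h2
    · rw [abs_of_nonneg (by linarith)] at k3 k4
      rcases le_total (a + f) (b - y) with h | h
      · rw [add_comm] at h1
        exact (exp_add_exp_le_of_le hord h (by linarith)).trans h1
      · rw [add_comm] at h3
        exact (exp_add_exp_le_of_le hord (by linarith) (by linarith)).trans h3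

theorem exp_add_exp_le_of_contraction {a b x y f g S : ℝ} (hf : |f| ≤ |x|) (hg : |g| ≤ |y|)
    (hfg : |f - g| ≤ |x - y|)
    (h1 : Real.exp (a + x) + Real.exp (b - y) ≤ S) (h2 : Real.exp (b + y) + Real.exp (a - x) ≤ S)
    (h3 : Real.exp (a + x) + Real.exp (a - x) ≤ S)
    (h4 : Real.exp (b + y) + Real.exp (b - y) ≤ S) :
    Real.exp (a + f) + Real.exp (b - g) ≤ S := by
  rcases le_total (b - g) (a + f) with hord | hord
  · exact exp_add_exp_le_of_ge hf hfg hord h1 h2 h3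
  · have := exp_add_exp_le_of_ge (a := b) (b := a) (x := -y) (y := -x) (f := -g) (g := -f) (S := S)
      (by simpa using hg) (by rw [neg_sub_neg, neg_sub_neg]; exact hfg) (by linarith)
      (by rw [← sub_eq_add_neg, sub_neg_eq_add]; linarith)
      (by rw [← sub_eq_add_neg, sub_neg_eq_add]; linarith)
      (by rw [← sub_eq_add_neg, sub_neg_eq_add]; linarith)
    rw [← sub_eq_add_neg, sub_neg_eq_add] at this
    linarith

/-- The one-coordinate **contraction principle** for exponential suprema. -/
theorem iSup_exp_contraction {I : Type*} [Nonempty I] {u x f : I → ℝ} (hf : ∀ i, |f i| ≤ |x i|)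
    (hff : ∀ i j, |f i - f j| ≤ |x i - x j|) :
    (⨆ i, ENNReal.ofReal (Real.exp (u i + f i))) + ⨆ i, ENNReal.ofReal (Real.exp (u i - f i))
      ≤ (⨆ i, ENNReal.ofReal (Real.exp (u i + x i)))
        + ⨆ i, ENNReal.ofReal (Real.exp (u i - x i)) := by
  set R := (⨆ i, ENNReal.ofReal (Real.exp (u i + x i)))
        + ⨆ i, ENNReal.ofReal (Real.exp (u i - x i)) with hR
  refine ENNReal.iSup_add_iSup_le fun i j => ?_
  by_cases htop : R = ⊤
  · rw [htop]; exact le_top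
  have key : ∀ i j, Real.exp (u i + x i) + Real.exp (u j - x j) ≤ R.toReal := by
    intro i j
    rw [← ENNReal.ofReal_le_iff_le_toReal htop,
      ENNReal.ofReal_add (Real.exp_pos _).le (Real.exp_pos _).le]
    exact add_le_add (le_iSup (fun i => ENNReal.ofReal (Real.exp (u i + x i))) i)
      (le_iSup (fun i => ENNReal.ofReal (Real.exp (u i - x i))) j)
  rw [← ENNReal.ofReal_add (Real.exp_pos _).le (Real.exp_pos _).le,
    ENNReal.ofReal_le_iff_le_toReal htop]
  exact exp_add_exp_le_of_contraction (hf i) (hf j) (hff i j) (key i j) (key j i) (key i i)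
    (key j j)

end Contraction

/-! ### Symmetrization and restricted strong convexity. -/

section Symmetrization

variable {m₁ m₂ : ℕ}

/-- The law of a random sign. -/
def signLaw : Measure Bool := (2⁻¹ : ENNReal) • (Measure.dirac true + Measure.dirac false)

/-- The real sign of a Boolean. -/
def sgn (b : Bool) : ℝ := if b then 1 else -1

theorem lintegral_signLaw (f : Bool → ENNReal) :
    ∫⁻ b, f b ∂signLaw = 2⁻¹ * (f true + f false) := by
  simp [signLaw, lintegral_add_measure, mul_add]

instance isProbabilityMeasure_signLaw : IsProbabilityMeasure signLaw := by
  constructor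
  have h := lintegral_signLaw 1
  simp only [Pi.one_apply, lintegral_one] at h
  rw [h, one_add_one_eq_two]
  exact ENNReal.inv_mul_cancel two_ne_zero ENNReal.ofNat_ne_top

theorem integral_signLaw (f : Bool → ℝ) : ∫ b, f b ∂signLaw = (f true + f false) / 2 := by
  rw [signLaw, integral_smul_measure, integral_add_measure (.of_finite) (.of_finite)]
  simp
  ring

/-- The squared `L²(Π)` norm. -/
def sqNorm (π A : Matrix (Fin m₁) (Fin m₂) ℝ) : ℝ := ∑ k, ∑ l, π k l * A k l ^ 2

/-- Jensen's inequality, from the tangent line of exp at the mean. -/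
theorem exp_mean_le_lintegral {π : Matrix (Fin m₁) (Fin m₂) ℝ} (hπ : IsDistribution π)
    (g : Fin m₁ × Fin m₂ → ℝ) :
    ENNReal.ofReal (Real.exp (∑ k, ∑ l, π k l * g (k, l)))
      ≤ ∫⁻ p, ENNReal.ofReal (Real.exp (g p)) ∂posLaw π := by
  rw [lintegral_posLaw]
  simp_rw [← ENNReal.ofReal_mul (hπ.nonneg _ _)]
  have h0 : ∀ k l, 0 ≤ π k l * Real.exp (g (k, l)) := fun k l =>
    mul_nonneg (hπ.nonneg k l) (Real.exp_pos _).le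
  simp_rw [← ENNReal.ofReal_sum_of_nonneg (fun l _ => h0 _ l)]
  rw [← ENNReal.ofReal_sum_of_nonneg (fun k _ => Finset.sum_nonneg fun l _ => h0 k l)]
  refine ENNReal.ofReal_le_ofReal ?_
  set m := ∑ k, ∑ l, π k l * g (k, l) with hm
  have h1 : ∀ k l, π k l * (Real.exp m * (g (k, l) - m + 1)) ≤ π k l * Real.exp (g (k, l)) := by
    intro k l
    refine mul_le_mul_of_nonneg_left ?_ (hπ.nonneg k l)
    have := Real.add_one_le_exp (g (k, l) - m)
    have h2 : Real.exp (g (k, l)) = Real.exp m * Real.exp (g (k, l) - m) := by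
      rw [← Real.exp_add]; ring_nf
    rw [h2]
    exact mul_le_mul_of_nonneg_left this (Real.exp_pos _).le
  refine le_trans (le_of_eq ?_)
    (Finset.sum_le_sum fun k _ => Finset.sum_le_sum fun l _ => h1 k l)
  have e : ∀ k l, π k l * (Real.exp m * (g (k, l) - m + 1))
      = Real.exp m * (π k l * g (k, l)) + Real.exp m * (1 - m) * π k l := fun k l => by ring
  simp only [e, Finset.sum_add_distrib, ← Finset.mul_sum, hπ.sum_eq_one, ← hm]
  ring

/-- Jensen introduces an independent copy p'. Convexity replaces exp(u + f(p') − f(p)) by the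
average of exp(u + 2f(p')) and exp(u − 2f(p)). Each depends on one point only, so the suprema
separate and the copy becomes the same variable as the original. -/
theorem lintegral_iSup_exp_symmetrize {π : Matrix (Fin m₁) (Fin m₂) ℝ} (hπ : IsDistribution π)
    {I : Type*} (u : I → ℝ) (f : I → Fin m₁ × Fin m₂ → ℝ) :
    ∫⁻ p, ⨆ i, ENNReal.ofReal (Real.exp (u i + (∑ k, ∑ l, π k l * f i (k, l) - f i p))) ∂posLaw π
      ≤ ∫⁻ p, 2⁻¹ * ((⨆ i, ENNReal.ofReal (Real.exp (u i + 2 * f i p)))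
          + ⨆ i, ENNReal.ofReal (Real.exp (u i - 2 * f i p))) ∂posLaw π := by
  have := isProbabilityMeasure_posLaw hπ
  set Φ : Fin m₁ × Fin m₂ → ENNReal := fun p => ⨆ i, ENNReal.ofReal (Real.exp (u i + 2 * f i p))
  set Ψ : Fin m₁ × Fin m₂ → ENNReal := fun p => ⨆ i, ENNReal.ofReal (Real.exp (u i - 2 * f i p))
  have hpt : ∀ p, ⨆ i, ENNReal.ofReal (Real.exp (u i + (∑ k, ∑ l, π k l * f i (k, l) - f i p)))
      ≤ ∫⁻ p', 2⁻¹ * (Φ p' + Ψ p) ∂posLaw π := by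
    intro p
    refine iSup_le fun i => ?_
    have h1 := exp_mean_le_lintegral hπ (fun p' => u i + f i p' - f i p)
    have e : ∑ k, ∑ l, π k l * (u i + f i (k, l) - f i p)
        = u i + (∑ k, ∑ l, π k l * f i (k, l) - f i p) := by
      have e' : ∀ k l, π k l * (u i + f i (k, l) - f i p)
          = π k l * f i (k, l) + (u i - f i p) * π k l := fun k l => by ring
      simp only [e', Finset.sum_add_distrib, ← Finset.mul_sum, hπ.sum_eq_one]
      ring
    rw [e] at h1
    refine h1.trans (lintegral_mono fun p' => ?_)
    have h2 : Real.exp (u i + f i p' - f i p)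
        ≤ 2⁻¹ * (Real.exp (u i + 2 * f i p') + Real.exp (u i - 2 * f i p)) := by
      have := exp_add_exp_le_of_le (p := u i + f i p' - f i p) (q := u i + f i p' - f i p)
        (p' := max (u i + 2 * f i p') (u i - 2 * f i p))
        (q' := min (u i + 2 * f i p') (u i - 2 * f i p)) le_rfl
        (by rcases le_total (u i + 2 * f i p') (u i - 2 * f i p) with h | h
            · rw [max_eq_right h]; linarith
            · rw [max_eq_left h]; linarith)
        (by rw [max_add_min]; linarith)
      rcases le_total (u i + 2 * f i p') (u i - 2 * f i p) with h | h
      · rw [max_eq_right h, min_eq_left h] at this; linarith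
      · rw [max_eq_left h, min_eq_right h] at this; linarith
    refine (ENNReal.ofReal_le_ofReal h2).trans ?_
    rw [ENNReal.ofReal_mul (by norm_num), ENNReal.ofReal_add (Real.exp_pos _).le
      (Real.exp_pos _).le, ENNReal.ofReal_inv_of_pos two_pos, ENNReal.ofReal_ofNat]
    refine mul_le_mul_right (add_le_add ?_ ?_) _
    · exact le_iSup (fun i => ENNReal.ofReal (Real.exp (u i + 2 * f i p'))) i
    · exact le_iSup (fun i => ENNReal.ofReal (Real.exp (u i - 2 * f i p))) i
  refine (lintegral_mono hpt).trans (le_of_eq ?_)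
  have m1 : Measurable Φ := measurable_of_finite _
  have m2 : Measurable Ψ := measurable_of_finite _
  change _ = ∫⁻ p, 2⁻¹ * (Φ p + Ψ p) ∂posLaw π
  simp_rw [lintegral_const_mul 2⁻¹ (measurable_of_finite _), lintegral_add_left m1,
    lintegral_add_left measurable_const, lintegral_const, measure_univ, mul_one]

/-- Symmetrization doubles s·t², and on [−1, 1] the map t ↦ t²/2 is a contraction vanishing at 0, so
2st² is dominated by 4st. -/
theorem lintegral_iSup_exp_sq_le {π : Matrix (Fin m₁) (Fin m₂) ℝ} (hπ : IsDistribution π)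
    {I : Type*} [Nonempty I] {A : I → Matrix (Fin m₁) (Fin m₂) ℝ} (hA : ∀ i, MaxNormLE (A i) 1)
    {s : ℝ} (u : I → ℝ) :
    ∫⁻ p, ⨆ i, ENNReal.ofReal (Real.exp (u i + s * (sqNorm π (A i) - A i p.1 p.2 ^ 2))) ∂posLaw π
      ≤ ∫⁻ z, ⨆ i, ENNReal.ofReal (Real.exp (u i + 4 * s * (sgn z.2 * A i z.1.1 z.1.2)))
          ∂(posLaw π).prod signLaw := by
  have := isProbabilityMeasure_posLaw hπ
  rw [lintegral_prod _ (measurable_of_finite _).aemeasurable]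
  have h := lintegral_iSup_exp_symmetrize hπ u (fun i p => s * A i p.1 p.2 ^ 2)
  have e : ∀ i (p : Fin m₁ × Fin m₂), ∑ k, ∑ l, π k l * (s * A i k l ^ 2) - s * A i p.1 p.2 ^ 2
      = s * (sqNorm π (A i) - A i p.1 p.2 ^ 2) := by
    intro i p
    have e' : ∀ k l, π k l * (s * A i k l ^ 2) = s * (π k l * A i k l ^ 2) := fun k l => by ring
    simp only [e', ← Finset.mul_sum, sqNorm]
    ring
  simp only [e] at h
  refine h.trans (lintegral_mono fun p => ?_)
  rw [lintegral_signLaw]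
  refine mul_le_mul_right ?_ _
  have hc := iSup_exp_contraction (u := u) (x := fun i => 4 * s * A i p.1 p.2)
    (f := fun i => 2 * (s * A i p.1 p.2 ^ 2)) (fun i => ?_) (fun i j => ?_)
  · simpa only [sgn, if_true, Bool.false_eq_true, if_false, one_mul, neg_mul, mul_neg,
      ← sub_eq_add_neg] using hc
  · have h1 := hA i p.1 p.2
    have e1 : 2 * (s * A i p.1 p.2 ^ 2) = (4 * s * A i p.1 p.2) * (A i p.1 p.2 / 2) := by ring
    rw [e1, abs_mul]
    refine mul_le_of_le_one_right (abs_nonneg _) ?_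
    rw [abs_div, abs_two]; linarith
  · have h1 := abs_le.mp (hA i p.1 p.2)
    have h2 := abs_le.mp (hA j p.1 p.2)
    have e1 : 2 * (s * A i p.1 p.2 ^ 2) - 2 * (s * A j p.1 p.2 ^ 2)
        = (4 * s * A i p.1 p.2 - 4 * s * A j p.1 p.2) * ((A i p.1 p.2 + A j p.1 p.2) / 2) := by
      ring
    rw [e1, abs_mul]
    refine mul_le_of_le_one_right (abs_nonneg _) ?_
    rw [abs_le]; constructor <;> linarith

/-- Symmetrization and contraction for the exponential moment of the deviation of the empirical
squared norm from its mean. -/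
theorem lintegral_iSup_exp_sum_sq_le {π : Matrix (Fin m₁) (Fin m₂) ℝ} (hπ : IsDistribution π)
    {I : Type*} [Nonempty I] {A : I → Matrix (Fin m₁) (Fin m₂) ℝ} (hA : ∀ i, MaxNormLE (A i) 1)
    {s : ℝ} (n : ℕ) (u : I → ℝ) :
    ∫⁻ e, ⨆ i, ENNReal.ofReal (Real.exp (u i
        + ∑ j, s * (sqNorm π (A i) - A i (e j).1 (e j).2 ^ 2)))
        ∂Measure.pi (fun _ : Fin n => posLaw π)
      ≤ ∫⁻ z, ⨆ i, ENNReal.ofReal (Real.exp (u i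
          + ∑ j, 4 * s * (sgn (z j).2 * A i (z j).1.1 (z j).1.2)))
          ∂Measure.pi (fun _ : Fin n => (posLaw π).prod signLaw) := by
  have := isProbabilityMeasure_posLaw hπ
  induction n generalizing u with
  | zero => simp
  | succ n ih =>
    rw [lintegral_pi_succ _ (measurable_of_finite _), lintegral_pi_succ _ (measurable_of_finite _)]
    simp only [Fin.sum_univ_succ, Fin.cons_zero, Fin.cons_succ]
    -- Coordinates are replaced one at a time: the other terms of the sum are absorbed into `u`, and
    -- Tonelli moves the coordinate to be replaced innermost.
    calc _ ≤ ∫⁻ a, ∫⁻ z, ⨆ i, ENNReal.ofReal (Real.exp (u i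
              + s * (sqNorm π (A i) - A i a.1 a.2 ^ 2)
              + ∑ j, 4 * s * (sgn (z j).2 * A i (z j).1.1 (z j).1.2)))
              ∂Measure.pi (fun _ : Fin n => (posLaw π).prod signLaw) ∂posLaw π := by
          refine lintegral_mono fun a => ?_
          have := ih (fun i => u i + s * (sqNorm π (A i) - A i a.1 a.2 ^ 2))
          simpa only [← add_assoc] using this
      _ = ∫⁻ z, ∫⁻ a, ⨆ i, ENNReal.ofReal (Real.exp (u i
              + s * (sqNorm π (A i) - A i a.1 a.2 ^ 2)
              + ∑ j, 4 * s * (sgn (z j).2 * A i (z j).1.1 (z j).1.2)))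
              ∂posLaw π ∂Measure.pi (fun _ : Fin n => (posLaw π).prod signLaw) :=
          lintegral_lintegral_swap (measurable_of_finite _).aemeasurable
      _ ≤ ∫⁻ z, ∫⁻ w, ⨆ i, ENNReal.ofReal (Real.exp (u i
              + 4 * s * (sgn w.2 * A i w.1.1 w.1.2)
              + ∑ j, 4 * s * (sgn (z j).2 * A i (z j).1.1 (z j).1.2)))
              ∂(posLaw π).prod signLaw ∂Measure.pi (fun _ : Fin n => (posLaw π).prod signLaw) := by
          refine lintegral_mono fun z => ?_
          have := lintegral_iSup_exp_sq_le hπ hA (s := s)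
            (fun i => u i + ∑ j, 4 * s * (sgn (z j).2 * A i (z j).1.1 (z j).1.2))
          simpa only [add_right_comm] using this
      _ = _ := by
          rw [lintegral_lintegral_swap (measurable_of_finite _).aemeasurable]
          simp only [← add_assoc]

-- The dilation has zero diagonal, so its Rayleigh quotient at a basis vector is 0. This makes the
-- logarithm of the trace nonnegative, hence usable as an operator-norm bound.
open NormedSpace in
theorem one_le_trace_exp_dil (hm : 0 < m₁) (M : Matrix (Fin m₁) (Fin m₂) ℝ) :
    1 ≤ (exp (dil M)).trace := by
  have h := exp_dotProduct_mulVec_le (dil_isSymm M)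
    (x := Pi.single (Sum.inl (⟨0, hm⟩ : Fin m₁)) (1 : ℝ)) (by simp)
  simpa [dil_apply] using h

theorem traceInner_sum_smul {ι : Type*} [Fintype ι] (c : ι → ℝ)
    (Z : ι → Matrix (Fin m₁) (Fin m₂) ℝ) (A : Matrix (Fin m₁) (Fin m₂) ℝ) :
    traceInner (∑ j, c j • Z j) A = ∑ j, c j * traceInner (Z j) A := by
  simp [traceInner, Matrix.transpose_sum, Matrix.sum_mul, Matrix.trace_sum]

/-- The dual form of a bound `G` on the nuclear norm. -/
def NuclearLE (A : Matrix (Fin m₁) (Fin m₂) ℝ) (G : ℝ) : Prop :=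
  ∀ Z z, 0 ≤ z → OpNormLE Z z → traceInner Z A ≤ z * G

-- The trace exponential itself certifies the operator-norm bound log(trace)/(sG) for `M`; inserting
-- it into the nuclear bound for `A` gives the inequality. The right side no longer depends on `A`,
-- which linearizes the supremum.
open NormedSpace in
theorem exp_traceInner_le (hm : 0 < m₁) {A M : Matrix (Fin m₁) (Fin m₂) ℝ} {G s : ℝ}
    (hs : 0 < s) (hG : 0 < G) (hA : NuclearLE A G) :
    Real.exp (s * traceInner M A) ≤ (exp ((s * G) • dil M)).trace := by
  have hθ : 0 < s * G := mul_pos hs hG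
  have h1 : 1 ≤ (exp ((s * G) • dil M)).trace := by
    rw [← map_smul]; exact one_le_trace_exp_dil hm _
  set R := (exp ((s * G) • dil M)).trace
  have ht : 0 ≤ Real.log R / (s * G) := div_nonneg (Real.log_nonneg h1) hθ.le
  have hop : OpNormLE M (Real.log R / (s * G)) := by
    refine opNormLE_of_trace_exp_le hθ ht ?_
    rw [mul_div_cancel₀ _ hθ.ne', Real.exp_log (by linarith)]
  have h2 := mul_le_mul_of_nonneg_left (hA M _ ht hop) hs.le
  rw [← Real.le_log_iff_exp_le (by linarith)]
  refine h2.trans (le_of_eq ?_)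
  field_simp

theorem cosh_sub_one_le {θ : ℝ} (h : |θ| ≤ 1) : Real.cosh θ - 1 ≤ θ ^ 2 := by
  have h1 := Real.cosh_le_exp_half_sq θ
  have h2 : θ ^ 2 ≤ 1 := (sq_le_one_iff_abs_le_one θ).mpr h
  have h3 := Real.abs_exp_sub_one_sub_id_le (x := θ ^ 2 / 2)
    (by rw [abs_of_nonneg (by positivity)]; linarith)
  have h4 := (abs_le.mp h3).2
  nlinarith [sq_nonneg θ]

/-- Uniform lower deviation of the empirical squared norm over matrices of bounded entries and
bounded nuclear norm. -/
theorem pi_posLaw_deviation_le {π : Matrix (Fin m₁) (Fin m₂) ℝ} (hπ : IsDistribution π)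
    (hm : 0 < m₁) {q : ℝ} (hrow : ∀ k, ∑ l, π k l ≤ q) (hcol : ∀ l, ∑ k, π k l ≤ q) (hq : 0 ≤ q)
    {s G : ℝ} (hs : 0 < s) (hG : 0 < G) (hθ : 4 * s * G ≤ 1) (n : ℕ) (v : ℝ) :
    Measure.pi (fun _ : Fin n => posLaw π)
      {e | ∃ A, MaxNormLE A 1 ∧ NuclearLE A G ∧
        v ≤ ∑ j, (sqNorm π A - A (e j).1 (e j).2 ^ 2)}
      ≤ ENNReal.ofReal ((m₁ + m₂ : ℝ) * Real.exp (n * (q * (4 * s * G) ^ 2) - s * v)) := by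
  have := isProbabilityMeasure_posLaw hπ
  set I := {A : Matrix (Fin m₁) (Fin m₂) ℝ // MaxNormLE A 1 ∧ NuclearLE A G}
  have : Nonempty I := ⟨⟨0, fun k l => by simp, fun Z z hz _ => by
    rw [traceInner_eq_sum]; simp only [Matrix.zero_apply, mul_zero, Finset.sum_const_zero]
    positivity⟩⟩
  set θ := 4 * s * G with hθd
  have hθ0 : 0 < θ := by positivity
  set Φ : (Fin n → Fin m₁ × Fin m₂) → ENNReal := fun e => ⨆ i : I, ENNReal.ofReal (Real.exp (0
        + ∑ j, s * (sqNorm π i.1 - i.1 (e j).1 (e j).2 ^ 2)))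
  have h1 : ∫⁻ e, Φ e ∂Measure.pi (fun _ : Fin n => posLaw π) ≤
      ENNReal.ofReal (1 + q * (θ ^ 2 + 0)) ^ n * ENNReal.ofReal (m₁ + m₂ : ℝ) := by
    refine (lintegral_iSup_exp_sum_sq_le hπ (A := fun i : I => i.1) (fun i => i.2.1) (s := s) n
      (fun _ => 0)).trans ?_
    -- For a fair sign the mean of sinh vanishes, so b = 0 and only the cosh term contributes.
    have hstep := fun (B : Matrix (Fin m₁ ⊕ Fin m₂) (Fin m₁ ⊕ Fin m₂) ℝ) (hB : B.IsSymm) =>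
      lintegral_trace_exp_add_le hπ hrow hcol (ρ := signLaw) (η := fun b => θ * sgn b)
      (measurable_of_finite _) .of_finite .of_finite (a := θ ^ 2) (b := 0)
      (by
        rw [integral_signLaw]
        simp only [sgn, if_true, Bool.false_eq_true, if_false, mul_one, mul_neg, Real.cosh_neg]
        have := cosh_sub_one_le (θ := θ) (by rw [abs_of_pos hθ0]; exact hθ)
        linarith)
      (by
        rw [integral_signLaw]
        simp [sgn]) hB
    have hmgf := lintegral_trace_exp_sum_le
      (X := fun z : (Fin m₁ × Fin m₂) × Bool => (θ * sgn z.2) • dil (posMatrix z.1))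
      (fun i j => measurable_of_finite _) (fun z => (dil_isSymm _).smul _) (n := n)
      (P := fun _ => (posLaw π).prod signLaw) (fun _ => hstep) (B := 0) Matrix.isSymm_zero
    rw [NormedSpace.exp_zero, Matrix.trace_one] at hmgf
    simp only [Fintype.card_sum, Fintype.card_fin, Nat.cast_add, zero_add] at hmgf
    refine le_trans (lintegral_mono fun z => iSup_le fun i => ENNReal.ofReal_le_ofReal ?_) hmgf
    have h2 := exp_traceInner_le hm (s := 4 * s) (M := ∑ j, sgn (z j).2 • posMatrix (z j).1)
      (by positivity) hG i.2.2
    have e1 : traceInner (∑ j, sgn (z j).2 • posMatrix (z j).1) i.1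
        = ∑ j, sgn (z j).2 * i.1 (z j).1.1 (z j).1.2 := by
      rw [traceInner_sum_smul]
      exact Finset.sum_congr rfl fun j _ => by rw [posMatrix, traceInner_single]
    rw [e1, ← hθd] at h2
    simp only [zero_add, ← Finset.mul_sum]
    refine h2.trans (le_of_eq ?_)
    congr 2
    rw [map_sum, Finset.smul_sum]
    refine Finset.sum_congr rfl fun j _ => ?_
    rw [map_smul, smul_smul]
  have h2 := mul_meas_ge_le_lintegral (μ := Measure.pi (fun _ : Fin n => posLaw π))
    (f := Φ) (measurable_of_finite _) (ENNReal.ofReal (Real.exp (s * v)))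
  have hsub : {e | ∃ A, MaxNormLE A 1 ∧ NuclearLE A G ∧
        v ≤ ∑ j, (sqNorm π A - A (e j).1 (e j).2 ^ 2)}
      ⊆ {e | ENNReal.ofReal (Real.exp (s * v)) ≤ Φ e} := by
    rintro e ⟨A, hA1, hA2, hv⟩
    refine le_trans (ENNReal.ofReal_le_ofReal (Real.exp_le_exp.mpr ?_))
      (le_iSup (fun i : I => ENNReal.ofReal (Real.exp (0
        + ∑ j, s * (sqNorm π i.1 - i.1 (e j).1 (e j).2 ^ 2)))) ⟨A, hA1, hA2⟩)
    rw [zero_add, ← Finset.mul_sum]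
    exact mul_le_mul_of_nonneg_left hv hs.le
  refine (measure_mono hsub).trans ?_
  have h3 : ENNReal.ofReal (Real.exp (s * v)) *
      Measure.pi (fun _ : Fin n => posLaw π) {e | ENNReal.ofReal (Real.exp (s * v)) ≤ Φ e}
      ≤ ENNReal.ofReal ((m₁ + m₂ : ℝ) * Real.exp (n * (q * θ ^ 2))) := by
    refine (h2.trans h1).trans ?_
    rw [← ENNReal.ofReal_pow (by positivity), ← ENNReal.ofReal_mul (by positivity), mul_comm]
    refine ENNReal.ofReal_le_ofReal (mul_le_mul_of_nonneg_left ?_ (by positivity))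
    rw [add_zero, Real.exp_nat_mul]
    refine pow_le_pow_left₀ (by positivity) ?_ n
    rw [add_comm]
    exact Real.add_one_le_exp _
  have hpos : ENNReal.ofReal (Real.exp (s * v)) ≠ 0 := by
    rw [ne_eq, ENNReal.ofReal_eq_zero, not_le]; exact Real.exp_pos _
  rw [mul_comm, ← ENNReal.le_div_iff_mul_le (.inl hpos) (.inl ENNReal.ofReal_ne_top),
    ← ENNReal.ofReal_div_of_pos (Real.exp_pos _)] at h3
  refine h3.trans (ENNReal.ofReal_le_ofReal (le_of_eq ?_))
  rw [Real.exp_sub, mul_div_assoc]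

end Symmetrization

/-! ### Hyperbolic moments of sub-exponential noise. -/

section Noise

theorem abs_exp_sub_one_sub_le (x : ℝ) : |Real.exp x - 1 - x| ≤ x ^ 2 * Real.exp |x| := by
  have h := Complex.norm_exp_sub_sum_le_norm_mul_exp (x : ℂ) 2
  simp only [Finset.sum_range_succ, Finset.sum_range_zero, Complex.norm_real, Real.norm_eq_abs,
    sq_abs] at h
  have e : Complex.exp (x : ℂ) - (0 + (x : ℂ) ^ 0 / (Nat.factorial 0 : ℕ)
      + (x : ℂ) ^ 1 / (Nat.factorial 1 : ℕ)) = ((Real.exp x - 1 - x : ℝ) : ℂ) := by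
    push_cast [Nat.factorial]
    ring
  rw [e, Complex.norm_real, Real.norm_eq_abs] at h
  exact h

theorem cosh_sub_one_le_sq_mul_exp (x : ℝ) : Real.cosh x - 1 ≤ x ^ 2 * Real.exp |x| := by
  have h1 := (abs_le.mp (abs_exp_sub_one_sub_le x)).2
  have h2 := (abs_le.mp (abs_exp_sub_one_sub_le (-x))).2
  rw [abs_neg, neg_sq] at h2
  rw [Real.cosh_eq]
  linarith

theorem abs_sinh_sub_le_sq_mul_exp (x : ℝ) : |Real.sinh x - x| ≤ x ^ 2 * Real.exp |x| := by
  have h1 := abs_le.mp (abs_exp_sub_one_sub_le x)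
  have h2 := abs_le.mp (abs_exp_sub_one_sub_le (-x))
  rw [abs_neg, neg_sq] at h2
  rw [Real.sinh_eq, abs_le]
  constructor <;> linarith [h1.1, h1.2, h2.1, h2.2]

/-- Half of the exponent |x|/c₀ pays for exp|θx|, the other half for the factor x². -/
theorem sq_mul_exp_abs_le {c₀ θ : ℝ} (hc : 0 < c₀) (hθ0 : 0 ≤ θ) (hθ : θ ≤ 1 / (2 * c₀)) (x : ℝ) :
    (θ * x) ^ 2 * Real.exp |θ * x| ≤ 8 * c₀ ^ 2 * θ ^ 2 * Real.exp (|x| / c₀) := by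
  set y := |x| / (2 * c₀) with hy
  have hy0 : 0 ≤ y := by positivity
  have hx : x ^ 2 = 4 * c₀ ^ 2 * y ^ 2 := by
    rw [hy, div_pow, sq_abs]; field_simp; norm_num
  have h1 : Real.exp |θ * x| ≤ Real.exp y := by
    rw [Real.exp_le_exp, abs_mul, abs_of_nonneg hθ0, hy]
    calc θ * |x| ≤ 1 / (2 * c₀) * |x| := mul_le_mul_of_nonneg_right hθ (abs_nonneg x)
      _ = |x| / (2 * c₀) := by ring
  have h2 : y ^ 2 ≤ 2 * Real.exp y := by
    have := Real.quadratic_le_exp_of_nonneg hy0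
    linarith
  have h3 : Real.exp (|x| / c₀) = Real.exp y * Real.exp y := by
    rw [← Real.exp_add, hy]; congr 1; field_simp; ring
  rw [mul_pow, hx, h3]
  calc _ ≤ θ ^ 2 * (4 * c₀ ^ 2 * (2 * Real.exp y)) * Real.exp y := by gcongr
    _ = _ := by ring

variable {Ω : Type*} [MeasurableSpace Ω] {μ : Measure Ω} [IsProbabilityMeasure μ]

/-- Bounds for the hyperbolic moments of a centered sub-exponential variable. -/
theorem subexponential_moments {X : Ω → ℝ} (hX : Measurable X) {c₀ : ℝ} (hc : 0 < c₀)
    (hXi : Integrable X μ) (hX0 : ∫ ω, X ω ∂μ = 0)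
    (hint : Integrable (fun ω => Real.exp (|X ω| / c₀)) μ)
    (hexp : ∫ ω, Real.exp (|X ω| / c₀) ∂μ ≤ Real.exp 1)
    {θ : ℝ} (hθ0 : 0 ≤ θ) (hθ : θ ≤ 1 / (2 * c₀)) :
    Integrable (fun ω => Real.cosh (θ * X ω)) μ ∧ Integrable (fun ω => Real.sinh (θ * X ω)) μ ∧
    ∫ ω, (Real.cosh (θ * X ω) - 1) ∂μ ≤ 8 * c₀ ^ 2 * θ ^ 2 * Real.exp 1 ∧
    |∫ ω, Real.sinh (θ * X ω) ∂μ| ≤ 8 * c₀ ^ 2 * θ ^ 2 * Real.exp 1 := by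
  have hdom : Integrable (fun ω => 8 * c₀ ^ 2 * θ ^ 2 * Real.exp (|X ω| / c₀)) μ :=
    hint.const_mul _
  have hb : ∫ ω, 8 * c₀ ^ 2 * θ ^ 2 * Real.exp (|X ω| / c₀) ∂μ
      ≤ 8 * c₀ ^ 2 * θ ^ 2 * Real.exp 1 := by
    rw [integral_const_mul]
    exact mul_le_mul_of_nonneg_left hexp (by positivity)
  have hc1 : ∀ ω, Real.cosh (θ * X ω) - 1 ≤ 8 * c₀ ^ 2 * θ ^ 2 * Real.exp (|X ω| / c₀) := fun ω =>
    (cosh_sub_one_le_sq_mul_exp _).trans (sq_mul_exp_abs_le hc hθ0 hθ _)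
  have hs1 : ∀ ω, |Real.sinh (θ * X ω) - θ * X ω| ≤ 8 * c₀ ^ 2 * θ ^ 2 * Real.exp (|X ω| / c₀) :=
    fun ω => (abs_sinh_sub_le_sq_mul_exp _).trans (sq_mul_exp_abs_le hc hθ0 hθ _)
  have hci : Integrable (fun ω => Real.cosh (θ * X ω) - 1) μ := by
    refine hdom.mono' ((Real.continuous_cosh.measurable.comp
      (hX.const_mul θ)).sub_const 1).aestronglyMeasurable (ae_of_all _ fun ω => ?_)
    rw [Real.norm_of_nonneg (by have := Real.one_le_cosh (θ * X ω); linarith)]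
    exact hc1 ω
  have hsi : Integrable (fun ω => Real.sinh (θ * X ω) - θ * X ω) μ :=
    hdom.mono' ((Real.continuous_sinh.measurable.comp
      (hX.const_mul θ)).sub (hX.const_mul θ)).aestronglyMeasurable (ae_of_all _ hs1)
  refine ⟨?_, ?_, (integral_mono hci hdom hc1).trans hb, ?_⟩
  · have := hci.add (integrable_const (1 : ℝ))
    simpa [Pi.add_def] using this
  · have := hsi.add (hXi.const_mul θ)
    simpa [Pi.add_def] using this
  -- Centering removes the linear term, so the mean of sinh is of second order in θ, like that of
  -- cosh − 1.
  · have e : ∫ ω, Real.sinh (θ * X ω) ∂μ = ∫ ω, (Real.sinh (θ * X ω) - θ * X ω) ∂μ := by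
      have := integral_add hsi (hXi.const_mul θ)
      simp only [sub_add_cancel] at this
      rw [this, integral_const_mul, hX0, mul_zero, add_zero]
    rw [e]
    exact (abs_integral_le_integral_abs).trans ((integral_mono hsi.abs hdom hs1).trans hb)

end Noise

/-! ### Probabilities of the two bad events. -/

section Events

open NormedSpace

variable {Ω : Type*} [MeasurableSpace Ω] {μ : Measure Ω} [IsProbabilityMeasure μ]
  {m₁ m₂ n : ℕ} {π A₀ : Matrix (Fin m₁) (Fin m₂) ℝ} {σ : ℝ}
  {T : Fin n → Ω → Matrix (Fin m₁) (Fin m₂) ℝ} {ξ Y : Fin n → Ω → ℝ}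

/-- The operator norm of the noise matrix is large only with small probability. -/
theorem measure_noise_opNorm_le (hπ : IsDistribution π) (hT : TraceRegression μ π A₀ σ T ξ Y)
    {c₀ : ℝ} (hc : 0 < c₀) (hξ : SubExponential μ ξ c₀)
    {q : ℝ} (hrow : ∀ k, ∑ l, π k l ≤ q) (hcol : ∀ l, ∑ k, π k l ≤ q) (hq : 0 ≤ q)
    {θ : ℝ} (hθ0 : 0 < θ) (hθ : θ ≤ 1 / (2 * c₀)) {t : ℝ} (ht : 0 ≤ t) :
    μ {ω | ¬ OpNormLE (∑ i, ξ i ω • T i ω) t}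
      ≤ ENNReal.ofReal ((m₁ + m₂ : ℝ) *
          Real.exp (n * (q * (16 * c₀ ^ 2 * Real.exp 1 * θ ^ 2)) - θ * t)) := by
  have := isProbabilityMeasure_posLaw hπ
  have hTm : ∀ i, Measurable fun ω => (T i ω, ξ i ω) := fun i =>
    (hT.measurable_T i).prodMk (hT.measurable_noise i)
  set b := 8 * c₀ ^ 2 * θ ^ 2 * Real.exp 1 with hb
  have hb0 : 0 ≤ b := by positivity
  set X : Matrix (Fin m₁) (Fin m₂) ℝ × ℝ → Matrix (Fin m₁ ⊕ Fin m₂) (Fin m₁ ⊕ Fin m₂) ℝ :=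
    fun z => (θ * z.2) • dil z.1 with hX
  have hXm : ∀ i j, Measurable fun z => X z i j := by
    have hentry : ∀ k l, Measurable fun z : Matrix (Fin m₁) (Fin m₂) ℝ × ℝ => z.1 k l := fun k l =>
      (measurable_pi_apply l).comp ((measurable_pi_apply k).comp measurable_fst)
    intro i j
    simp only [hX, Matrix.smul_apply, smul_eq_mul]
    refine (measurable_snd.const_mul θ).mul ?_
    rcases i with i | i <;> rcases j with j | j <;> simp [dil_apply, hentry]
  have hpm : Measurable (posMatrix : Fin m₁ × Fin m₂ → Matrix (Fin m₁) (Fin m₂) ℝ) :=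
    measurable_of_finite _
  have hmeas : ∀ {k : ℕ} (B : Matrix (Fin m₁ ⊕ Fin m₂) (Fin m₁ ⊕ Fin m₂) ℝ),
      Measurable fun e : Fin k → Matrix (Fin m₁) (Fin m₂) ℝ × ℝ =>
      ENNReal.ofReal (exp (B + ∑ i, X (e i))).trace := by
    intro k B
    have h1 : Measurable fun e : Fin k → Matrix (Fin m₁) (Fin m₂) ℝ × ℝ =>
        fun (i j : Fin m₁ ⊕ Fin m₂) => (B + ∑ k, X (e k)) i j := by
      refine measurable_pi_lambda _ fun i => measurable_pi_lambda _ fun j => ?_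
      simp only [Matrix.add_apply, Matrix.sum_apply]
      exact measurable_const.add
        (Finset.measurable_fun_sum _ fun k _ => (hXm i j).comp (measurable_pi_apply k))
    have h2 : Continuous fun M : (Fin m₁ ⊕ Fin m₂) → (Fin m₁ ⊕ Fin m₂) → ℝ =>
        (exp (Matrix.of M)).trace := continuous_trace_exp.comp continuous_id
    exact (h2.measurable.comp h1).ennreal_ofReal
  have hstep : ∀ i, ∀ B : Matrix (Fin m₁ ⊕ Fin m₂) (Fin m₁ ⊕ Fin m₂) ℝ, B.IsSymm →
      ∫⁻ e, ENNReal.ofReal (exp (B + X e)).trace ∂μ.map (fun ω => (T i ω, ξ i ω))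
        ≤ ENNReal.ofReal (1 + q * (b + b)) * ENNReal.ofReal (exp B).trace := by
    intro i B hB
    have hm1 : Measurable fun e => ENNReal.ofReal (exp (B + X e)).trace := by
      simpa [Function.comp_def] using (hmeas (k := 1) B).comp
        (measurable_pi_lambda (fun (a : Matrix (Fin m₁) (Fin m₂) ℝ × ℝ) (_ : Fin 1) => a)
          fun _ => measurable_id)
    -- Independence of design and noise presents the pair as an image of position × noise, the form
    -- needed for the one-step bound.
    have hlaw : μ.map (fun ω => (T i ω, ξ i ω))
        = ((posLaw π).prod (μ.map (ξ i))).map (Prod.map posMatrix id) := by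
      have : IsProbabilityMeasure (μ.map (ξ i)) :=
        Measure.isProbabilityMeasure_map (hT.measurable_noise i).aemeasurable
      rw [(indepFun_iff_map_prod_eq_prod_map_map (hT.measurable_T i).aemeasurable
        (hT.measurable_noise i).aemeasurable).mp (hT.indep_noise i), hT.law_T i,
        ← map_posMatrix_posLaw, ← Measure.map_prod_map _ _ hpm measurable_id, Measure.map_id]
    have : IsProbabilityMeasure (μ.map (ξ i)) :=
      Measure.isProbabilityMeasure_map (hT.measurable_noise i).aemeasurable
    rw [hlaw, lintegral_map hm1 (hpm.prodMap measurable_id)]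
    have hmid : AEMeasurable (ξ i) μ := (hT.measurable_noise i).aemeasurable
    have hmo := subexponential_moments (μ := μ.map (ξ i)) (X := fun y => y) measurable_id hc
      ((integrable_map_measure aestronglyMeasurable_id hmid).mpr (hT.noise_integrable i))
      (by rw [integral_map hmid (f := fun y => y) (by fun_prop)]; exact hT.noise_mean i)
      ((integrable_map_measure (by fun_prop) hmid).mpr (hξ i).1)
      (by rw [integral_map hmid (by fun_prop)]; exact (hξ i).2) hθ0.le hθ
    exact lintegral_trace_exp_add_le hπ hrow hcol (η := fun y => θ * y) (by fun_prop)
      hmo.1 hmo.2.1 hmo.2.2.1 hmo.2.2.2 hB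
  have : ∀ i, IsProbabilityMeasure (μ.map (fun ω => (T i ω, ξ i ω))) := fun i =>
    Measure.isProbabilityMeasure_map (hTm i).aemeasurable
  have hmgf := lintegral_trace_exp_sum_le hXm (fun z => (dil_isSymm _).smul _) hstep (n := n)
    (B := 0) Matrix.isSymm_zero
  rw [← (iIndepFun_iff_map_fun_eq_pi_map fun i => (hTm i).aemeasurable).mp hT.indep_pairs,
    lintegral_map (hmeas 0) (measurable_pi_lambda _ hTm), NormedSpace.exp_zero,
    Matrix.trace_one] at hmgf
  simp only [Fintype.card_sum, Fintype.card_fin, Nat.cast_add, zero_add] at hmgf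
  have hsum : ∀ ω, ∑ i, X (T i ω, ξ i ω) = θ • dil (∑ i, ξ i ω • T i ω) := by
    intro ω
    simp only [hX, map_sum, map_smul, Finset.smul_sum, smul_smul]
  simp only [hsum] at hmgf
  set Φ : Ω → ENNReal := fun ω => ENNReal.ofReal (exp (θ • dil (∑ i, ξ i ω • T i ω))).trace with hΦ
  have hΦm : Measurable Φ := by
    have h := (hmeas (k := n) 0).comp (measurable_pi_lambda (fun ω i => (T i ω, ξ i ω)) hTm)
    simpa only [Function.comp_def, zero_add, hsum] using h
  have h2 := mul_meas_ge_le_lintegral (μ := μ) hΦm (ENNReal.ofReal (Real.exp (θ * t)))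
  have hsub : {ω | ¬ OpNormLE (∑ i, ξ i ω • T i ω) t}
      ⊆ {ω | ENNReal.ofReal (Real.exp (θ * t)) ≤ Φ ω} := by
    intro ω hω
    by_contra hcon
    refine hω (opNormLE_of_trace_exp_le hθ0 ht ?_)
    simp only [hΦ, Set.mem_ofPred_eq, not_le] at hcon
    exact ((ENNReal.ofReal_lt_ofReal_iff (Real.exp_pos _)).mp hcon).le
  refine (measure_mono hsub).trans ?_
  have h3 : ENNReal.ofReal (Real.exp (θ * t)) *
      μ {ω | ENNReal.ofReal (Real.exp (θ * t)) ≤ Φ ω}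
      ≤ ENNReal.ofReal ((m₁ + m₂ : ℝ) * Real.exp (n * (q * (16 * c₀ ^ 2 * Real.exp 1 * θ ^ 2)))) := by
    refine (h2.trans hmgf).trans ?_
    rw [← ENNReal.ofReal_pow (by positivity), ← ENNReal.ofReal_mul (by positivity), mul_comm]
    refine ENNReal.ofReal_le_ofReal (mul_le_mul_of_nonneg_left ?_ (by positivity))
    rw [Real.exp_nat_mul]
    refine pow_le_pow_left₀ (by positivity) ?_ n
    rw [add_comm, show b + b = 16 * c₀ ^ 2 * Real.exp 1 * θ ^ 2 by rw [hb]; ring]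
    exact Real.add_one_le_exp _
  have hpos : ENNReal.ofReal (Real.exp (θ * t)) ≠ 0 := by
    rw [ne_eq, ENNReal.ofReal_eq_zero, not_le]; exact Real.exp_pos _
  rw [mul_comm, ← ENNReal.le_div_iff_mul_le (.inl hpos) (.inl ENNReal.ofReal_ne_top),
    ← ENNReal.ofReal_div_of_pos (Real.exp_pos _)] at h3
  refine h3.trans (ENNReal.ofReal_le_ofReal (le_of_eq ?_))
  rw [Real.exp_sub, mul_div_assoc]

/-- A property of the positions that holds with high probability under the product law holds with
the same probability for the sampled indicator matrices. -/
theorem measure_design_le (hπ : IsDistribution π) (hT : TraceRegression μ π A₀ σ T ξ Y)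
    (bad : Set (Fin n → Fin m₁ × Fin m₂)) :
    μ {ω | ¬ ∃ e, e ∉ bad ∧ ∀ i, T i ω = posMatrix (e i)}
      ≤ Measure.pi (fun _ : Fin n => posLaw π) bad := by
  have := isProbabilityMeasure_posLaw hπ
  have hpm : Measurable (posMatrix : Fin m₁ × Fin m₂ → Matrix (Fin m₁) (Fin m₂) ℝ) :=
    measurable_of_finite _
  have hind : iIndepFun T μ :=
    hT.indep_pairs.comp (fun _ => Prod.fst) (fun _ => measurable_fst)
  set S : (Fin n → Fin m₁ × Fin m₂) → Fin n → Matrix (Fin m₁) (Fin m₂) ℝ :=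
    fun e i => posMatrix (e i) with hS
  have hlaw : μ.map (fun ω i => T i ω) = (Measure.pi (fun _ : Fin n => posLaw π)).map S := by
    have : ∀ _ : Fin n, IsProbabilityMeasure ((posLaw π).map posMatrix) := fun _ =>
      Measure.isProbabilityMeasure_map hpm.aemeasurable
    rw [(iIndepFun_iff_map_fun_eq_pi_map fun i => (hT.measurable_T i).aemeasurable).mp hind,
      Measure.pi_map_pi fun _ => hpm.aemeasurable]
    simp only [hT.law_T, map_posMatrix_posLaw]
  have : MeasurableSingletonClass (Matrix (Fin m₁) (Fin m₂) ℝ) :=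
    inferInstanceAs (MeasurableSingletonClass (Fin m₁ → Fin m₂ → ℝ))
  -- There are finitely many designs, so the event is measurable whatever the set `bad` is.
  have hF : MeasurableSet (S '' badᶜ)ᶜ := (Set.toFinite _).measurableSet.compl
  have e1 : {ω | ¬ ∃ e, e ∉ bad ∧ ∀ i, T i ω = posMatrix (e i)}
      = (fun ω i => T i ω) ⁻¹' (S '' badᶜ)ᶜ := by
    ext ω
    simp only [Set.mem_ofPred_eq, Set.mem_preimage, Set.mem_compl_iff, Set.mem_image, hS,
      funext_iff, eq_comm]
  rw [e1, ← Measure.map_apply (measurable_pi_lambda _ hT.measurable_T) hF, hlaw,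
    Measure.map_apply (measurable_of_finite _) hF]
  refine measure_mono fun e he => ?_
  by_contra hbad
  exact he ⟨e, hbad, rfl⟩

end Events

/-! ### Deterministic analysis on the good event. -/

section Deterministic

variable {m₁ m₂ n : ℕ}

/-- The basic inequality for the penalized estimator. -/
theorem basic_inequality {t : Fin n → Matrix (Fin m₁) (Fin m₂) ℝ} {y ξ : Fin n → ℝ}
    {A₀ X : Matrix (Fin m₁) (Fin m₂) ℝ} {lam a ζ σ z : ℝ} (hn : 0 < n) (ha : 0 < a) (hζ : 0 ≤ ζ)
    (hσ : 0 ≤ σ) (hz : 0 ≤ z) (hlam : 0 ≤ lam)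
    (hy : ∀ i, y i = traceInner (t i) A₀ + σ * ξ i)
    (hA₀ : MaxNormLE A₀ ζ) (hX : IsEstimator t y lam a ζ X)
    (hop : OpNormLE (∑ i, ξ i • t i) (n * z)) :
    (1 / (n : ℝ)) * ∑ i, traceInner (t i) (X - A₀) ^ 2
      ≤ 2 * σ * z * (svTail X A₀.rank + 3 * (√A₀.rank * frobNorm (X - A₀)))
        + lam * ((1 + a) / a * (√A₀.rank * frobNorm (X - A₀))
          - (1 + a) / (a + ζ * √(m₁ * m₂ : ℝ)) * svTail X A₀.rank) := by
  have hn' : (0 : ℝ) < n := by exact_mod_cast hn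
  have h1 := hX.2 A₀ hA₀
  have hsub : ∀ i, traceInner (t i) X = traceInner (t i) A₀ + traceInner (t i) (X - A₀) := by
    intro i
    simp only [traceInner, Matrix.mul_sub, Matrix.trace_sub]; ring
  have e1 : ∑ i, (y i - traceInner (t i) X) ^ 2 = ∑ i, (y i - traceInner (t i) A₀) ^ 2
      - 2 * σ * traceInner (∑ i, ξ i • t i) (X - A₀) + ∑ i, traceInner (t i) (X - A₀) ^ 2 := by
    rw [traceInner_sum_smul, Finset.mul_sum, ← Finset.sum_sub_distrib, ← Finset.sum_add_distrib]
    refine Finset.sum_congr rfl fun i _ => ?_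
    rw [hy, hsub]; ring
  rw [objective, objective, e1] at h1
  have h2 := traceInner_sub_le (X := X) (A := A₀) (by positivity) hop
  have h3 := mul_le_mul_of_nonneg_left
    (TL1_sub_le (A := A₀) (X := X) ha (frobNorm_le_of_maxNormLE hζ hX.1)) hlam
  have h4 : (1 / (n : ℝ)) * (2 * σ * traceInner (∑ i, ξ i • t i) (X - A₀))
      ≤ 2 * σ * z * (svTail X A₀.rank + 3 * (√A₀.rank * frobNorm (X - A₀))) := by
    calc _ ≤ (1 / (n : ℝ)) * (2 * σ * (n * z * (svTail X A₀.rank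
            + 3 * (√A₀.rank * frobNorm (X - A₀))))) := by gcongr
      _ = _ := by field_simp
  rw [mul_sub] at h3
  rw [mul_add, mul_sub] at h1
  linarith

theorem frobNorm_sq_le_sqNorm {π : Matrix (Fin m₁) (Fin m₂) ℝ} {ν : ℝ} (hm₁ : 0 < m₁)
    (hm₂ : 0 < m₂) (hν : 0 < ν) (hπ : EntriesComparable π ν) (A : Matrix (Fin m₁) (Fin m₂) ℝ) :
    frobNorm A ^ 2 ≤ ν * (m₁ * m₂ : ℝ) * sqNorm π A := by
  have hM : (0 : ℝ) < m₁ * m₂ := by positivity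
  rw [frobNorm_sq, sqNorm, Finset.mul_sum]
  refine Finset.sum_le_sum fun k _ => ?_
  rw [Finset.mul_sum]
  refine Finset.sum_le_sum fun l _ => ?_
  have h := (hπ k l).1
  rw [div_le_iff₀ (by positivity)] at h
  nlinarith [sq_nonneg (A k l)]

theorem NuclearLE.smul {A : Matrix (Fin m₁) (Fin m₂) ℝ} {G c : ℝ} (hc : 0 ≤ c)
    (h : NuclearLE A G) : NuclearLE (c • A) (c * G) := by
  intro Z z hz hZ
  have e : traceInner Z (c • A) = c * traceInner Z A := by simp [traceInner]
  rw [e]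
  calc _ ≤ c * (z * G) := mul_le_mul_of_nonneg_left (h Z z hz hZ) hc
    _ = _ := by ring

/-- Restricted strong convexity: either the perturbation is small, or its empirical norm controls
its `L²(Π)` norm. -/
theorem sqNorm_le_or_lt {π D : Matrix (Fin m₁) (Fin m₂) ℝ} {e : Fin n → Fin m₁ × Fin m₂}
    {ζ κ T N : ℝ} (hn : 0 < n) (hT : 0 ≤ T)
    (hD : MaxNormLE D (2 * ζ)) (hN : NuclearLE D N) (hNκ : N ≤ √(κ * sqNorm π D))
    (he : e ∉ {e | ∃ A, MaxNormLE A 1 ∧ NuclearLE A √(κ * T) ∧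
        n * T / 2 ≤ ∑ j, (sqNorm π A - A (e j).1 (e j).2 ^ 2)}) :
    sqNorm π D ≤ 4 * ζ ^ 2 * T ∨
      sqNorm π D ≤ 2 * ((1 / (n : ℝ)) * ∑ j, D (e j).1 (e j).2 ^ 2) := by
  have hn' : (0 : ℝ) < n := by exact_mod_cast hn
  set V := sqNorm π D with hV
  rcases le_or_gt V (4 * ζ ^ 2 * T) with h | h
  · exact Or.inl h
  right
  have hV0 : 0 < V := lt_of_le_of_lt (by positivity) h
  -- If T = 0, the zero matrix already puts `e` in the excluded set.
  rcases hT.eq_or_lt with hT0 | hT0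
  · exfalso
    refine he ⟨0, fun k l => by simp, fun Z z _ _ => ?_, ?_⟩
    · rw [← hT0]; simp [traceInner]
    · rw [← hT0]; simp [sqNorm]
  -- Shrinking `D` to squared L²(Π) norm exactly T brings its entries below 1, as V > 4ζ²T, and its
  -- nuclear bound to √(κT). An empirical norm below half of V would then violate the deviation
  -- bound at this one radius.
  set c := √(T / V) with hc
  have hc2 : c ^ 2 = T / V := Real.sq_sqrt (by positivity)
  by_contra! hlt
  refine he ⟨c • D, fun k l => ?_, fun Z z hz hZ => ?_, ?_⟩
  · rw [Matrix.smul_apply, smul_eq_mul, abs_mul, abs_of_nonneg (Real.sqrt_nonneg _)]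
    have h1 : c * |D k l| ≤ c * (2 * ζ) := mul_le_mul_of_nonneg_left (hD k l) (Real.sqrt_nonneg _)
    refine h1.trans (abs_le_of_sq_le_sq' (b := (1 : ℝ)) ?_ zero_le_one).2
    rw [mul_pow, hc2, one_pow, div_mul_eq_mul_div, div_le_one hV0]
    linarith [h]
  · refine ((hN.smul (Real.sqrt_nonneg _)) Z z hz hZ).trans (mul_le_mul_of_nonneg_left ?_ hz)
    refine (mul_le_mul_of_nonneg_left hNκ (Real.sqrt_nonneg _)).trans (le_of_eq ?_)
    rw [← Real.sqrt_mul (by positivity)]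
    congr 1
    field_simp
  · have e1 : sqNorm π (c • D) = T := by
      have : sqNorm π (c • D) = c ^ 2 * V := by
        rw [hV, sqNorm, sqNorm, Finset.mul_sum]
        refine Finset.sum_congr rfl fun k _ => ?_
        rw [Finset.mul_sum]
        refine Finset.sum_congr rfl fun l _ => ?_
        rw [Matrix.smul_apply, smul_eq_mul]; ring
      rw [this, hc2, div_mul_cancel₀ _ hV0.ne']
    simp only [e1, Matrix.smul_apply, smul_eq_mul, mul_pow, hc2, Finset.sum_sub_distrib,
      Finset.sum_const, Finset.card_univ, Fintype.card_fin, nsmul_eq_mul, ← Finset.mul_sum]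
    have h2 : ∑ j, D (e j).1 (e j).2 ^ 2 ≤ n * V / 2 := by
      have : 2 * ((1 / (n : ℝ)) * ∑ j, D (e j).1 (e j).2 ^ 2) * n
          = 2 * ∑ j, D (e j).1 (e j).2 ^ 2 := by field_simp
      nlinarith
    have h3 := mul_le_mul_of_nonneg_left h2 (div_nonneg hT hV0.le)
    have h4 : T / V * (n * V / 2) = n * T / 2 := by field_simp
    linarith

/-- The deterministic error bound on the event where the noise matrix has small operator norm and
the design satisfies restricted strong convexity. -/
theorem frobNorm_sq_le_of_events {π A₀ X : Matrix (Fin m₁) (Fin m₂) ℝ}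
    {e : Fin n → Fin m₁ × Fin m₂} {y ξ : Fin n → ℝ} {lam a ζ σ ν ρ c c' K H C₅ C₆ : ℝ}
    (hm₁ : 0 < m₁) (hm₂ : 0 < m₂) (hn : 0 < n) (ha : 0 < a) (hζ : 0 ≤ ζ) (hσ : 0 < σ)
    (hν : 0 < ν) (hρ : 0 < ρ) (hc : 0 < c) (hc' : 0 ≤ c') (hH : 0 ≤ H) (hπ0 : IsDistribution π)
    (hπ : EntriesComparable π ν)
    (hC₅ : C₅ = 6 * c + c' * (1 + K)) (hC₆ : C₆ = C₅ / (2 * c) + 3) (hK : 0 < K)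
    (hlow : 4 * c * (max ζ σ * ρ * ((a + ζ * √(m₁ * m₂ : ℝ)) / (1 + a))) ≤ lam)
    (hup : lam ≤ c' * (max ζ σ * ρ * ((a + ζ * √(m₁ * m₂ : ℝ)) / (1 + a))))
    (hKa : ζ * √(m₁ * m₂ : ℝ) ≤ K * a)
    (hy : ∀ i, y i = traceInner (posMatrix (e i)) A₀ + σ * ξ i)
    (hA₀ : MaxNormLE A₀ ζ) (hX : IsEstimator (fun i => posMatrix (e i)) y lam a ζ X)
    (hop : OpNormLE (∑ i, ξ i • posMatrix (e i)) (n * (c * ρ)))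
    (he : e ∉ {e | ∃ A, MaxNormLE A 1 ∧
        NuclearLE A √(C₆ ^ 2 * max (A₀.rank : ℝ) 1 * ν * (m₁ * m₂ : ℝ) *
          (H * (C₆ ^ 2 * max (A₀.rank : ℝ) 1 * ν * (m₁ * m₂ : ℝ)) * ρ ^ 2)) ∧
        n * (H * (C₆ ^ 2 * max (A₀.rank : ℝ) 1 * ν * (m₁ * m₂ : ℝ)) * ρ ^ 2) / 2
          ≤ ∑ j, (sqNorm π A - A (e j).1 (e j).2 ^ 2)}) :
    frobNorm (X - A₀) ^ 2 / (m₁ * m₂ : ℝ) ≤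
      (4 * C₅ ^ 2 + 4 * H * C₆ ^ 2) * ν ^ 2 * max ζ σ ^ 2 * A₀.rank * (ρ ^ 2 * (m₁ * m₂ : ℝ)) := by
  have hM : (0 : ℝ) < m₁ * m₂ := by positivity
  set M : ℝ := (m₁ * m₂ : ℝ) with hMd
  set w := max ζ σ with hw
  have hw0 : 0 < w := lt_max_of_lt_right hσ
  have hσw : σ ≤ w := le_max_right _ _
  have hζw : ζ ≤ w := le_max_left _ _
  set r := A₀.rank with hr
  set F := frobNorm (X - A₀) with hF
  have hF0 : 0 ≤ F := frobNorm_nonneg _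
  set S := svTail X r with hS
  have hS0 : 0 ≤ S := svTail_nonneg _ _
  set x := w * ρ with hx
  have hx0 : 0 < x := mul_pos hw0 hρ
  set g' := (a + ζ * √M) / (1 + a) with hg'
  have hζM : 0 ≤ ζ * √M := by positivity
  have hg'0 : 0 < g' := by positivity
  have hlam0 : 0 ≤ lam := le_trans (by positivity) hlow
  have hinv : (1 + a) / (a + ζ * √M) * g' = 1 := by rw [hg']; field_simp
  have hb : (1 + a) / a * g' ≤ 1 + K := by
    have e1 : (1 + a) / a * g' = (a + ζ * √M) / a := by rw [hg']; field_simp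
    rw [e1, div_le_iff₀ ha]; linarith
  have hC₅0 : 0 < C₅ := by rw [hC₅]; positivity
  have hC₆0 : 0 < C₆ := by rw [hC₆]; positivity
  set R := √r * F with hR
  have hR0 : 0 ≤ R := by positivity
  set emp := (1 / (n : ℝ)) * ∑ i, traceInner (posMatrix (e i)) (X - A₀) ^ 2 with hemp
  have hemp0 : 0 ≤ emp := by positivity
  have hbasic : emp ≤ x * (C₅ * R - 2 * c * S) := by
    have h0 := basic_inequality hn ha hζ hσ.le (mul_pos hc hρ).le hlam0 hy hA₀ hX hop
    rw [← hemp] at h0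
    have h1 : 2 * σ * (c * ρ) * (S + 3 * R) ≤ 2 * c * x * (S + 3 * R) := by
      have : 2 * σ * (c * ρ) ≤ 2 * c * x := by
        rw [hx]
        have := mul_le_mul_of_nonneg_right hσw (mul_pos hc hρ).le
        linarith
      exact mul_le_mul_of_nonneg_right this (by positivity)
    have h2 : lam * ((1 + a) / a * R) ≤ c' * (1 + K) * x * R := by
      have h3 : lam * ((1 + a) / a) ≤ c' * (1 + K) * x := by
        calc _ ≤ c' * (x * g') * ((1 + a) / a) :=
              mul_le_mul_of_nonneg_right hup (by positivity)
          _ = c' * x * ((1 + a) / a * g') := by ring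
          _ ≤ c' * x * (1 + K) := mul_le_mul_of_nonneg_left hb (by positivity)
          _ = _ := by ring
      calc _ = lam * ((1 + a) / a) * R := by ring
        _ ≤ _ := mul_le_mul_of_nonneg_right h3 hR0
    -- The penalty pays for the tail at twice the noise rate 2cx; the surplus 2cxS is what bounds
    -- `S`.
    have h4 : 4 * c * x * S ≤ lam * ((1 + a) / (a + ζ * √M) * S) := by
      have h5 : 4 * c * x ≤ lam * ((1 + a) / (a + ζ * √M)) := by
        calc 4 * c * x = 4 * c * (x * g') * ((1 + a) / (a + ζ * √M)) := by
              linear_combination (-(4 * c * x)) * hinv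
          _ ≤ _ := mul_le_mul_of_nonneg_right hlow (by positivity)
      calc _ ≤ lam * ((1 + a) / (a + ζ * √M)) * S := mul_le_mul_of_nonneg_right h5 hS0
        _ = _ := by ring
    rw [mul_sub] at h0
    rw [hC₅]
    linarith
  have hSR : S ≤ C₅ / (2 * c) * R := by
    have h1 : 0 ≤ C₅ * R - 2 * c * S := by
      by_contra! hneg
      have := mul_neg_of_pos_of_neg hx0 hneg
      linarith
    rw [div_mul_eq_mul_div, le_div_iff₀ (by positivity)]
    linarith
  have hempR : emp ≤ C₅ * x * R := by
    have : 0 ≤ x * (2 * c * S) := by positivity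
    linarith
  -- The tail contributes C₅/(2c) and the perturbation bound contributes 3, which together make up
  -- `C₆`.
  have hnuc : NuclearLE (X - A₀) (C₆ * R) := by
    intro Z z hz hZ
    refine (traceInner_sub_le hz hZ).trans (mul_le_mul_of_nonneg_left ?_ hz)
    rw [hC₆]; linarith
  have hpos : 0 ≤ (4 * C₅ ^ 2 + 4 * H * C₆ ^ 2) * ν ^ 2 * w ^ 2 * r * (ρ ^ 2 * M) := by positivity
  -- For rank zero the nuclear bound vanishes; pairing Δ with itself forces Δ = 0.
  by_cases hr0 : r = 0
  · have h1 := hnuc (X - A₀) F hF0 (opNormLE_frobNorm _)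
    rw [traceInner_self, ← hF, hR, hr0] at h1
    simp only [Nat.cast_zero, Real.sqrt_zero, zero_mul, mul_zero] at h1
    have h2 : F ^ 2 / M ≤ 0 := div_nonpos_of_nonpos_of_nonneg h1 hM.le
    exact h2.trans hpos
  have hr1 : max (r : ℝ) 1 = r := max_eq_left (by exact_mod_cast Nat.one_le_iff_ne_zero.mpr hr0)
  rw [hr1] at he
  set V := sqNorm π (X - A₀) with hV
  have hV0 : 0 ≤ V := Finset.sum_nonneg fun k _ => Finset.sum_nonneg fun l _ =>
    mul_nonneg (hπ0.nonneg k l) (sq_nonneg _)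
  have hFV : F ^ 2 ≤ ν * M * V := frobNorm_sq_le_sqNorm hm₁ hm₂ hν hπ _
  have hRV : R ≤ √(r * ν * M * V) := by
    refine Real.le_sqrt_of_sq_le ?_
    rw [hR, mul_pow, Real.sq_sqrt (Nat.cast_nonneg r)]
    have := mul_le_mul_of_nonneg_left hFV (Nat.cast_nonneg (α := ℝ) r)
    linarith
  have hmain := sqNorm_le_or_lt (ζ := ζ) (κ := C₆ ^ 2 * r * ν * M) hn (by positivity)
    (D := X - A₀) (fun k l => by
      rw [Matrix.sub_apply]
      have h1 := abs_sub (X k l) (A₀ k l)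
      have h2 := hX.1 k l
      have h3 := hA₀ k l
      linarith) hnuc (by
      have e1 : √(C₆ ^ 2 * r * ν * M * V) = C₆ * √(r * ν * M * V) := by
        rw [show C₆ ^ 2 * r * ν * M * V = C₆ ^ 2 * (r * ν * M * V) by ring,
          Real.sqrt_mul (sq_nonneg _), Real.sqrt_sq hC₆0.le]
      rw [← hV, e1]
      exact mul_le_mul_of_nonneg_left hRV hC₆0.le) he
  rw [div_le_iff₀ hM]
  refine hFV.trans ?_
  rcases hmain with h | h
  · have h1 : ζ ^ 2 ≤ w ^ 2 := pow_le_pow_left₀ hζ hζw 2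
    calc ν * M * V ≤ ν * M * (4 * w ^ 2 * (H * (C₆ ^ 2 * r * ν * M) * ρ ^ 2)) := by
          refine mul_le_mul_of_nonneg_left (h.trans ?_) (by positivity)
          exact mul_le_mul_of_nonneg_right (by linarith) (by positivity)
      _ = 4 * H * C₆ ^ 2 * (ν ^ 2 * w ^ 2 * r * (ρ ^ 2 * M) * M) := by ring
      _ ≤ (4 * C₅ ^ 2 + 4 * H * C₆ ^ 2) * (ν ^ 2 * w ^ 2 * r * (ρ ^ 2 * M) * M) :=
          mul_le_mul_of_nonneg_right (by linarith [sq_nonneg C₅]) (by positivity)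
      _ = _ := by ring
  · have h1 : V ≤ 2 * (C₅ * x * √(r * ν * M * V)) := by
      refine h.trans (mul_le_mul_of_nonneg_left ?_ two_pos.le)
      have e1 : (1 / (n : ℝ)) * ∑ j, (X - A₀) (e j).1 (e j).2 ^ 2 = emp := by
        simp only [hemp, posMatrix, traceInner_single]
      rw [e1]
      exact hempR.trans (mul_le_mul_of_nonneg_left hRV (by positivity))
    have h2 : V ≤ 4 * C₅ ^ 2 * x ^ 2 * (r * ν * M) := by
      -- The self-bounding inequality V ≤ const·√V is squared and one factor V cancelled.
      rcases hV0.eq_or_lt with h0 | h0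
      · rw [← h0]; positivity
      · have h3 := pow_le_pow_left₀ hV0 h1 2
        rw [mul_pow, mul_pow, Real.sq_sqrt (by positivity)] at h3
        have h4 : V * V ≤ (4 * C₅ ^ 2 * x ^ 2 * (r * ν * M)) * V := by
          calc V * V = V ^ 2 := by ring
            _ ≤ _ := h3
            _ = _ := by ring
        exact le_of_mul_le_mul_right h4 h0
    calc ν * M * V ≤ ν * M * (4 * C₅ ^ 2 * x ^ 2 * (r * ν * M)) :=
          mul_le_mul_of_nonneg_left h2 (by positivity)
      _ = 4 * C₅ ^ 2 * (ν ^ 2 * w ^ 2 * r * (ρ ^ 2 * M) * M) := by rw [hx]; ring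
      _ ≤ (4 * C₅ ^ 2 + 4 * H * C₆ ^ 2) * (ν ^ 2 * w ^ 2 * r * (ρ ^ 2 * M) * M) :=
          mul_le_mul_of_nonneg_right (by linarith [mul_nonneg hH (sq_nonneg C₆)]) (by positivity)
      _ = _ := by ring

end Deterministic

/-! ### Calibration of the deviation bounds. -/

section Rates

variable {m₁ m₂ n : ℕ}

/-- 1/min is at most 1/m₁ + 1/m₂ = d/(m₁m₂), which makes the marginal bound the square of the rate
up to log d / n. -/
theorem marginal_rate_le {L : ℝ} (hm₁ : 0 < m₁) (hm₂ : 0 < m₂)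
    (hL : 0 ≤ L) : L / (min m₁ m₂ : ℕ) ≤ L * (m₁ + m₂ : ℝ) / (m₁ * m₂ : ℝ) := by
  have h1 : (0 : ℝ) < m₁ := by exact_mod_cast hm₁
  have h2 : (0 : ℝ) < m₂ := by exact_mod_cast hm₂
  have hmin : (0 : ℝ) < (min m₁ m₂ : ℕ) := by exact_mod_cast lt_min hm₁ hm₂
  rw [div_le_div_iff₀ hmin (by positivity), mul_assoc]
  refine mul_le_mul_of_nonneg_left ?_ hL
  rcases le_total m₁ m₂ with h | h
  · rw [min_eq_left h]; nlinarith
  · rw [min_eq_right h]; nlinarith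

/-- On an event of probability at least `1 - 2 / d` both the noise and the design are
well behaved. -/
theorem measure_bad_le {Ω : Type*} [MeasurableSpace Ω] {μ : Measure Ω} [IsProbabilityMeasure μ]
    {π A₀ : Matrix (Fin m₁) (Fin m₂) ℝ} {σ : ℝ} {T : Fin n → Ω → Matrix (Fin m₁) (Fin m₂) ℝ}
    {ξ Y : Fin n → Ω → ℝ} {c₀ cₙ L c κ : ℝ} (hm₁ : 0 < m₁) (hm₂ : 0 < m₂) (hL : 1 ≤ L)
    (hc₀ : 0 < c₀) (hcₙ : 0 < cₙ) (hκ : 0 < κ) (hn : 0 < n)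
    (hc : c * (√cₙ / (2 * c₀)) = 2 + 16 * c₀ ^ 2 * Real.exp 1 * (√cₙ / (2 * c₀)) ^ 2)
    (hπ : IsDistribution π) (hT : TraceRegression μ π A₀ σ T ξ Y) (hM : MarginalsLE π L)
    (hξ : SubExponential μ ξ c₀)
    (hsize : cₙ * ((m₁ + m₂ : ℝ) * Real.log (m₁ + m₂ : ℝ)) ≤ n) {ρ : ℝ} (hρ0 : 0 < ρ)
    (hρ : ρ ^ 2 = L * (m₁ + m₂ : ℝ) / (m₁ * m₂ : ℝ) * Real.log (m₁ + m₂ : ℝ) / n) :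
    μ ({ω | ¬ OpNormLE (∑ i, ξ i ω • T i ω) (n * (c * ρ))} ∪
      {ω | ¬ ∃ e : Fin n → Fin m₁ × Fin m₂, e ∉ {e | ∃ A, MaxNormLE A 1 ∧
          NuclearLE A √(κ * (512 * (1 + 2 / cₙ) * κ * ρ ^ 2)) ∧
          n * (512 * (1 + 2 / cₙ) * κ * ρ ^ 2) / 2
            ≤ ∑ j : Fin n, (sqNorm π A - A (e j).1 (e j).2 ^ 2)} ∧
        ∀ i, T i ω = posMatrix (e i)}) ≤ ENNReal.ofReal (2 / (m₁ + m₂ : ℝ)) := by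
  have h1 : (1 : ℝ) ≤ m₁ := by exact_mod_cast hm₁
  have h2 : (1 : ℝ) ≤ m₂ := by exact_mod_cast hm₂
  have hn' : (0 : ℝ) < n := by exact_mod_cast hn
  set d : ℝ := (m₁ + m₂ : ℝ) with hd
  have hd2 : 2 ≤ d := by linarith
  set l := Real.log d with hl
  have hl0 : 0 < l := Real.log_pos (by linarith)
  have hMM : (0 : ℝ) < m₁ * m₂ := by positivity
  set q := L * d / (m₁ * m₂ : ℝ) with hq
  have hq0 : 0 < q := by positivity
  have hrow : ∀ k, ∑ l, π k l ≤ q := fun k =>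
    (hM.1 k).trans (marginal_rate_le hm₁ hm₂ (by linarith))
  have hcol : ∀ l, ∑ k, π k l ≤ q := fun k =>
    (hM.2 k).trans (marginal_rate_le hm₁ hm₂ (by linarith))
  -- The squared scale of the Laplace parameters: n·q·w2 = log d. The sample size condition gives
  -- w2·cₙ ≤ 1, which keeps them admissible.
  set w2 := l / (n * q) with hw2
  have hw20 : 0 < w2 := by positivity
  have hw2le : w2 * cₙ ≤ 1 := by
    have e1 : w2 * cₙ = (cₙ * l * (m₁ * m₂ : ℝ)) / (n * (L * d)) := by
      rw [hw2, hq]; field_simp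
    rw [e1, div_le_one (by positivity)]
    have hle : (m₁ * m₂ : ℝ) ≤ d * d := by rw [hd]; nlinarith
    calc cₙ * l * (m₁ * m₂ : ℝ) ≤ cₙ * l * (d * d) :=
          mul_le_mul_of_nonneg_left hle (by positivity)
      _ = (cₙ * (d * l)) * d := by ring
      _ ≤ n * d := mul_le_mul_of_nonneg_right hsize (by linarith)
      _ ≤ n * (L * d) := mul_le_mul_of_nonneg_left (by nlinarith) hn'.le
  have hexp_d : d * Real.exp (-(2 * l)) = 1 / d := by
    rw [Real.exp_neg, two_mul, Real.exp_add, hl, Real.exp_log (by linarith)]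
    field_simp
  have hfin : ∀ x : ℝ, x ≤ -(2 * l) → ENNReal.ofReal (d * Real.exp x) ≤ ENNReal.ofReal (1 / d) := by
    intro x hx
    refine ENNReal.ofReal_le_ofReal ?_
    rw [← hexp_d]
    exact mul_le_mul_of_nonneg_left (Real.exp_le_exp.mpr hx) (by linarith)
  have hρw : n * ρ * √w2 = l := by
    have e1 : (n * ρ * √w2) ^ 2 = l ^ 2 := by
      rw [mul_pow, mul_pow, Real.sq_sqrt hw20.le, hρ, hw2]; field_simp
    exact (sq_eq_sq₀ (by positivity) hl0.le).mp e1
  have hb1 : μ {ω | ¬ OpNormLE (∑ i, ξ i ω • T i ω) (n * (c * ρ))} ≤ ENNReal.ofReal (1 / d) := by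
    set γ := √cₙ / (2 * c₀) with hγ
    have hγ0 : 0 < γ := by positivity
    have hc0 : 0 < c := by
      by_contra! hneg
      have h3 : c * γ ≤ 0 := mul_nonpos_of_nonpos_of_nonneg hneg hγ0.le
      have h4 : 0 ≤ 16 * c₀ ^ 2 * Real.exp 1 * γ ^ 2 := by positivity
      linarith
    refine (measure_noise_opNorm_le hπ hT hc₀ hξ hrow hcol hq0.le (θ := γ * √w2)
      (by positivity) ?_ (by positivity)).trans (hfin _ (le_of_eq ?_))
    · have e1 : γ * √w2 = √(w2 * cₙ) / (2 * c₀) := by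
        rw [Real.sqrt_mul hw20.le, hγ]; ring
      rw [e1]
      exact div_le_div_of_nonneg_right (Real.sqrt_le_one.mpr hw2le) (by positivity)
    -- The equation imposed on `c` makes the exponent exactly −2 log d; one factor d is lost to the
    -- dimension, leaving 1/d.
    · have e2 : n * q * w2 = l := by rw [hw2]; field_simp
      rw [mul_pow, Real.sq_sqrt hw20.le]
      linear_combination (16 * c₀ ^ 2 * Real.exp 1 * γ ^ 2) * e2 - c * γ * hρw - l * hc
  have hb2 := measure_design_le hπ hT {e | ∃ A, MaxNormLE A 1 ∧
          NuclearLE A √(κ * (512 * (1 + 2 / cₙ) * κ * ρ ^ 2)) ∧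
          n * (512 * (1 + 2 / cₙ) * κ * ρ ^ 2) / 2
            ≤ ∑ j : Fin n, (sqNorm π A - A (e j).1 (e j).2 ^ 2)}
  have hb3 : Measure.pi (fun _ : Fin n => posLaw π) {e | ∃ A, MaxNormLE A 1 ∧
          NuclearLE A √(κ * (512 * (1 + 2 / cₙ) * κ * ρ ^ 2)) ∧
          n * (512 * (1 + 2 / cₙ) * κ * ρ ^ 2) / 2
            ≤ ∑ j : Fin n, (sqNorm π A - A (e j).1 (e j).2 ^ 2)} ≤ ENNReal.ofReal (1 / d) := by
    -- The value of `h` ensures h ≥ 1 and h·cₙ ≥ 2. With s = 1/(64κqh), the moment cost is 2l/h ≤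
    -- 2l, the deviation gain is 512/(2·64)·l = 4l, and 4sG ≤ 1.
    set h := 1 + 2 / cₙ with hh
    have hh1 : 1 ≤ h := by
      have : 0 ≤ 2 / cₙ := by positivity
      linarith
    have hh0 : 0 < h := by linarith
    have hhc : 2 ≤ h * cₙ := by
      rw [hh, add_mul, div_mul_cancel₀ _ hcₙ.ne']; linarith
    set G := √(κ * (512 * h * κ * ρ ^ 2)) with hG
    have hG2 : G ^ 2 = κ * (512 * h * κ * ρ ^ 2) := Real.sq_sqrt (by positivity)
    have hθ2 : (4 * (1 / (64 * κ * q * h)) * G) ^ 2 = 2 * w2 / h := by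
      rw [mul_pow, hG2, hρ, hw2]; field_simp; norm_num
    refine (pi_posLaw_deviation_le hπ hm₁ hrow hcol hq0.le (s := 1 / (64 * κ * q * h)) (G := G)
      (by positivity) (by positivity) ?_ n _).trans (hfin _ ?_)
    · refine (abs_le_of_sq_le_sq' (b := (1 : ℝ)) ?_ zero_le_one).2
      rw [hθ2, one_pow, div_le_one hh0]
      have h3 : w2 * 2 ≤ w2 * (h * cₙ) := mul_le_mul_of_nonneg_left hhc hw20.le
      have h4 : h * (w2 * cₙ) ≤ h * 1 := mul_le_mul_of_nonneg_left hw2le hh0.le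
      linarith
    · rw [hθ2, hρ]
      have e1 : n * (q * (2 * w2 / h)) = 2 * l / h := by rw [hw2]; field_simp
      have e2 : 1 / (64 * κ * q * h) * (n * (512 * h * κ * (q * l / n)) / 2) = 4 * l := by
        field_simp; norm_num
      rw [e1, e2]
      have : 2 * l / h ≤ 2 * l := div_le_self (by positivity) hh1
      linarith
  refine (measure_union_le _ _).trans ((add_le_add hb1 (hb2.trans hb3)).trans (le_of_eq ?_))
  rw [← ENNReal.ofReal_add (by positivity) (by positivity)]
  congr 1
  ring

end Rates

end TLone

end

/-! ### Choice of constants and conclusion. -/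

theorem theorem2 :
    -- `κ` depends on `L` only
    ∃ κ : ℝ → ℝ,
    -- `c₀`: sub-exponential constant; `cₙ`: implied constant of `n ≳ d log d`
    ∀ c₀ : ℝ, 0 < c₀ → ∀ cₙ : ℝ, 0 < cₙ →
    -- the lower implied constant in the choice of `λ` has to be large enough
    ∃ cLow : ℝ, 0 < cLow ∧
    -- `cUp`: upper implied constant in the choice of `λ`; `K`: implied constant of `1/a = O(⋯)`
    ∀ cUp : ℝ, cLow ≤ cUp → ∀ K : ℝ, 0 < K →
    ∃ C₃ C₄ : ℝ, 0 < C₃ ∧ 0 < C₄ ∧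
    ∀ (m₁ m₂ n τ : ℕ), 0 < m₁ → 0 < m₂ →
    ∀ (L ν σ ζ a lam : ℝ), 1 ≤ L → 1 ≤ ν → 0 < σ → 0 < a →
    ∀ (Ω : Type*) [MeasurableSpace Ω] (μ : Measure Ω) [IsProbabilityMeasure μ]
      (π A₀ : Matrix (Fin m₁) (Fin m₂) ℝ)
      (T : Fin n → Ω → Matrix (Fin m₁) (Fin m₂) ℝ) (ξ Y : Fin n → Ω → ℝ)
      (Ahat : Ω → Matrix (Fin m₁) (Fin m₂) ℝ),
      TLone.IsDistribution π →
      TLone.TraceRegression μ π A₀ σ T ξ Y →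
      TLone.MarginalsLE π L →
      TLone.EntriesComparable π ν →
      TLone.SubExponential μ ξ c₀ →
      A₀.rank ≤ τ →
      TLone.MaxNormLE A₀ ζ →
      cLow * TLone.lamRate m₁ m₂ n ζ σ a L ≤ lam →
      lam ≤ cUp * TLone.lamRate m₁ m₂ n ζ σ a L →
      cₙ * ((m₁ + m₂ : ℝ) * Real.log (m₁ + m₂ : ℝ)) ≤ n →
      ζ * √(m₁ * m₂ : ℝ) ≤ K * a →
      (∀ᵐ ω ∂μ, TLone.IsEstimator (fun i => T i ω) (fun i => Y i ω) lam a ζ (Ahat ω)) →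
      ∃ E : Set Ω, MeasurableSet E ∧
        1 - (κ L + 1) / (m₁ + m₂ : ℝ) ≤ μ.real E ∧
        ∀ ω ∈ E,
          TLone.frobNorm (Ahat ω - A₀) ^ 2 / (m₁ * m₂ : ℝ) ≤
            C₃ * ν ^ 2 * max (ζ ^ 2) (σ ^ 2) * (A₀.rank : ℝ) *
                (L * (m₁ + m₂ : ℝ) * Real.log (m₁ + m₂ : ℝ) / n) +
              C₄ * ν * ζ ^ 2 * √(L * Real.log (m₁ + m₂ : ℝ) / n) := by
  refine ⟨fun _ => 1, fun c₀ hc₀ cₙ hcₙ => ?_⟩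
  set γ := √cₙ / (2 * c₀) with hγ
  have hγ0 : 0 < γ := by positivity
  -- With γ the largest Laplace parameter allowed by the moment assumption at the minimal sample
  -- size, this `c` gives the noise tail 1/d.
  set c := (2 + 16 * c₀ ^ 2 * Real.exp 1 * γ ^ 2) / γ with hc
  have hc0 : 0 < c := by positivity
  have hcγ : c * γ = 2 + 16 * c₀ ^ 2 * Real.exp 1 * γ ^ 2 := div_mul_cancel₀ _ hγ0.ne'
  refine ⟨4 * c, by positivity, fun cUp hcUp K hK => ?_⟩
  have hcUp0 : 0 < cUp := lt_of_lt_of_le (by positivity) hcUp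
  set C₅ := 6 * c + cUp * (1 + K) with hC₅
  have hC₅0 : 0 < C₅ := by positivity
  set C₆ := C₅ / (2 * c) + 3 with hC₆
  have hC₆0 : 0 < C₆ := by positivity
  set H := 512 * (1 + 2 / cₙ) with hH
  have hH0 : 0 < H := by positivity
  -- The second error term is simply dropped at the end, so any positive `C₄` serves.
  refine ⟨4 * C₅ ^ 2 + 4 * H * C₆ ^ 2, 1, by positivity, one_pos, ?_⟩
  intro m₁ m₂ n τ hm₁ hm₂ L ν σ ζ a lam hL hν hσ ha Ω _ μ _ π A₀ T ξ Y Ahat hπ hT hM hE hξ _ hA₀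
    hlow hup hsize hKa hest
  have h1 : (1 : ℝ) ≤ m₁ := by exact_mod_cast hm₁
  have h2 : (1 : ℝ) ≤ m₂ := by exact_mod_cast hm₂
  have hζ : 0 ≤ ζ := (abs_nonneg _).trans (hA₀ ⟨0, hm₁⟩ ⟨0, hm₂⟩)
  have hd0 : (0 : ℝ) < m₁ + m₂ := by linarith
  have hl0 : 0 < Real.log (m₁ + m₂ : ℝ) := Real.log_pos (by linarith)
  have hMM : (0 : ℝ) < m₁ * m₂ := by positivity
  have hn' : (0 : ℝ) < n := lt_of_lt_of_le (by positivity) hsize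
  have hn : 0 < n := by exact_mod_cast hn'
  set ρ := √(L * (m₁ + m₂ : ℝ) * Real.log (m₁ + m₂ : ℝ) / n) / √(m₁ * m₂ : ℝ) with hρd
  have hρ0 : 0 < ρ := by positivity
  have hρ : ρ ^ 2 = L * (m₁ + m₂ : ℝ) / (m₁ * m₂ : ℝ) * Real.log (m₁ + m₂ : ℝ) / n := by
    rw [hρd, div_pow, Real.sq_sqrt (by positivity), Real.sq_sqrt hMM.le]; field_simp
  have hrate : TLone.lamRate m₁ m₂ n ζ σ a L
      = max ζ σ * ρ * ((a + ζ * √(m₁ * m₂ : ℝ)) / (1 + a)) := by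
    rw [TLone.lamRate, hρd]; ring
  rw [hrate] at hlow hup
  -- The maximum with 1 keeps this positive when `A₀` has rank zero.
  set κ := C₆ ^ 2 * max (A₀.rank : ℝ) 1 * ν * (m₁ * m₂ : ℝ) with hκ
  have hκ0 : 0 < κ := by
    have : (0 : ℝ) < max (A₀.rank : ℝ) 1 := lt_max_of_lt_right one_pos
    positivity
  have hbad := TLone.measure_bad_le (κ := κ) hm₁ hm₂ hL hc₀ hcₙ hκ0 hn hcγ hπ hT hM hξ hsize hρ0 hρ
  rw [← hH] at hbad
  set B₁ := {ω | ¬ TLone.OpNormLE (∑ i, ξ i ω • T i ω) (n * (c * ρ))}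
  set B₂ := {ω | ¬ ∃ e : Fin n → Fin m₁ × Fin m₂, e ∉ {e | ∃ A, TLone.MaxNormLE A 1 ∧
          TLone.NuclearLE A √(κ * (H * κ * ρ ^ 2)) ∧ n * (H * κ * ρ ^ 2) / 2
            ≤ ∑ j : Fin n, (TLone.sqNorm π A - A (e j).1 (e j).2 ^ 2)} ∧
        ∀ i, T i ω = TLone.posMatrix (e i)}
  set B₃ := {ω | ¬ TLone.IsEstimator (fun i => T i ω) (fun i => Y i ω) lam a ζ (Ahat ω)}
  have hB₃ : μ B₃ = 0 := hest
  -- The bad set need not be measurable, since the estimator is an arbitrary function; a measurable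
  -- hull has the same outer measure.
  set B := toMeasurable μ (B₁ ∪ B₂ ∪ B₃) with hB
  have hμB : μ.real B ≤ 2 / (m₁ + m₂ : ℝ) := by
    refine ENNReal.toReal_le_of_le_ofReal (by positivity) ?_
    rw [hB, measure_toMeasurable]
    refine (measure_union_le _ _).trans ?_
    rw [hB₃, add_zero]
    exact hbad
  have hBm : MeasurableSet B := measurableSet_toMeasurable _ _
  refine ⟨Bᶜ, hBm.compl, ?_, fun ω hω => ?_⟩
  · rw [probReal_compl_eq_one_sub hBm, one_add_one_eq_two]
    linarith
  · have hω' : ω ∉ B₁ ∪ B₂ ∪ B₃ := fun h => hω (subset_toMeasurable _ _ h)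
    simp only [Set.mem_union, not_or] at hω'
    obtain ⟨⟨hω1, hω2⟩, hω3⟩ := hω'
    have hop := not_not.mp hω1
    obtain ⟨e, he, hTe⟩ := not_not.mp hω2
    have hX := not_not.mp hω3
    simp only [hTe] at hop hX
    have hmain := TLone.frobNorm_sq_le_of_events hm₁ hm₂ hn ha hζ hσ (by linarith) hρ0 hc0
      hcUp0.le hH0.le hπ hE hC₅ hC₆ hK hlow hup hKa
      (fun i => by rw [hT.obs, hTe]) hA₀ hX hop he
    have hmax : max ζ σ ^ 2 = max (ζ ^ 2) (σ ^ 2) := by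
      rcases le_total ζ σ with h | h
      · rw [max_eq_right h, max_eq_right (pow_le_pow_left₀ hζ h 2)]
      · rw [max_eq_left h, max_eq_left (pow_le_pow_left₀ hσ.le h 2)]
    have hρM : ρ ^ 2 * (m₁ * m₂ : ℝ) = L * (m₁ + m₂ : ℝ) * Real.log (m₁ + m₂ : ℝ) / n := by
      rw [hρ]; field_simp
    rw [hmax, hρM] at hmain
    refine hmain.trans (le_add_of_nonneg_right ?_)
    have : 0 ≤ ν := by linarith
    positivity
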